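/- Model and problem. A set $N\subset\mathbb{N}$ of $n=|N|=2^{n'}$ players ($n'\ge 0$) is given, where player $i$ beats player $j$ if $i>j$. A seeding is a bijection from $N$ to the $n$ leaves, read from left to right, of a complete binary tree; in each round $r=1,\dots,n'$ the two players at sibling nodes play each other and the winner moves up to the parent node. For a game-value function $v:N\times N\times\mathbb{N}\to\mathbb{Z}$, the value of a seeding is the sum of $v(i,j,r)$ over all games played, where $i$ plays against $j$ in round $r$ (it is $0$ if $n=1$). In Tournament Value Maximization we are given $N$, $v$ and a target $V\in\mathbb{Z}$, and have to decide whether some seeding has value at least $V$. The function $v$ is player popularity-based with player popularity values $v_i\in\mathbb{Z}$ $(i\in N)$ if $v(i,j,r)=v_{\max(i,j)}$ for all $i,j\in N$ and $r\in\mathbb{N}$. The disagreement between the player popularity values and the strength ordering is the smallest integer $k$ such that there is a set $N'\subseteq N$ with $|N'|\le k$ and such that $v_i\ge v_j$ for all $i,j\in N\setminus N'$ with $i>j$. Such an instance is given to the algorithm as the list consisting of $n$, $V$ and, for every player $i$ from the strongest to the weakest, $i$ and $v_i$. Running time is the number of steps of a random access machine with unit-cost arithmetic ($+,-,\times$, integer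 division), comparisons and memory accesses on words of $O(\log M)$ bits, where $M$ is $2$ plus the largest absolute value of a number in the input list. Theorem. Tournament Value Maximization with a player popularity-based game-value function is solvable in $k^{O(k)}\cdot n^{1+o(1)}$ time, where $k$ is the disagreement between the player popularity values and the strength ordering. That is, there are a single program, a constant $C\in\mathbb{N}$ and a function $\varepsilon:\mathbb{N}\to\mathbb{R}$ with $\varepsilon(n)\to0$ as $n\to\infty$ such that on every such instance the program, with all computed numbers of absolute value at most $M^{C}$, halts with the correct answer after at most $C\cdot k^{Ck}\cdot n^{1+\varepsilon(n)}$ steps (where $0^0=1$). -/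

import Mathlib

open Filter Topology

/-! ### Tournaments -/

namespace Tournament

/-- The players seeded into the first half of the `2 ^ (m + 1)` leaves. -/
def firstHalf {m : ℕ} (p : Fin (2 ^ (m + 1)) → ℕ) : Fin (2 ^ m) → ℕ :=
  fun i => p ⟨i, lt_of_lt_of_le i.2 (Nat.pow_le_pow_right two_pos (Nat.le_succ m))⟩

/-- The players seeded into the second half of the `2 ^ (m + 1)` leaves. -/
def secondHalf {m : ℕ} (p : Fin (2 ^ (m + 1)) → ℕ) : Fin (2 ^ m) → ℕ :=
  fun i => p ⟨2 ^ m + i, by have := i.2; rw [pow_succ]; omega⟩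

/-- The winner of the knockout tournament with `m` rounds whose leaves, from left to right, are
labelled with the players `p 0, …, p (2 ^ m - 1)`. Player `i` beats player `j` if `i > j`. -/
def winner : (m : ℕ) → (Fin (2 ^ m) → ℕ) → ℕ
  | 0, p => p 0
  | m + 1, p => max (winner m (firstHalf p)) (winner m (secondHalf p))

/-- The sum of the values of all games played in the knockout tournament with `m` rounds whose
leaves are labelled by `p`, where `v i j r` is the value of a game of `i` against `j` in
round `r`. A tournament with a single player has no game. -/
def value (v : ℕ → ℕ → ℕ → ℤ) : (m : ℕ) → (Fin (2 ^ m) → ℕ) → ℤ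
  | 0, _ => 0
  | m + 1, p => value v m (firstHalf p) + value v m (secondHalf p)
      + v (winner m (firstHalf p)) (winner m (secondHalf p)) (m + 1)

/-- An instance of Tournament Value Maximization. Only the values of `gameValue` at players
matter. -/
structure Instance where
  /-- the set of players -/
  players : Finset ℕ
  /-- the number of rounds -/
  rounds : ℕ
  card_players : players.card = 2 ^ rounds
  /-- the game-value function -/
  gameValue : ℕ → ℕ → ℕ → ℤ
  /-- the target value -/
  target : ℤ

namespace Instance

/-- The number `n` of players. -/
def n (I : Instance) : ℕ := I.players.card

/-- A tournament seeding: an injective (equivalently, since both sets have the same finite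
cardinality, bijective) assignment of the players to the `n` seed positions, here numbered from
`0`. -/
abbrev Seeding (I : Instance) : Type := I.players ≃ Fin (2 ^ I.rounds)

/-- The tournament value of a seeding. -/
def tournamentValue (I : Instance) (σ : I.Seeding) : ℤ :=
  value I.gameValue I.rounds (fun q => (σ.symm q : ℕ))

/-- The instance is a yes-instance. -/
def IsYes (I : Instance) : Prop := ∃ σ : I.Seeding, I.target ≤ I.tournamentValue σ

/-- The game-value function is player popularity-based, with player popularity values `pop`. -/
def IsPopularityBased (I : Instance) (pop : ℕ → ℤ) : Prop :=
  ∀ i ∈ I.players, ∀ j ∈ I.players, ∀ r : ℕ, I.gameValue i j r = pop (max i j)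

/-- The popularity values agree with the strength ordering on the set `S`. -/
def AgreeOn (pop : ℕ → ℤ) (S : Finset ℕ) : Prop :=
  ∀ i ∈ S, ∀ j ∈ S, j < i → pop j ≤ pop i

/-- The disagreement between the player popularity values and the strength ordering: the least
`k` such that for some `N' ⊆ N` with `|N'| ≤ k` they agree on `N \ N'`. (There is such a `k`:
take `N' = N`.) -/
noncomputable def disagreement (I : Instance) (pop : ℕ → ℤ) : ℕ :=
  sInf {k : ℕ | ∃ N' ⊆ I.players, N'.card ≤ k ∧ AgreeOn pop (I.players \ N')}

/-- The input of an algorithm for player popularity-based game-value functions, as a sequence of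
integers: the number of players, the target value, and then for every player, from the strongest
to the weakest, the player and its popularity value. -/
def input (I : Instance) (pop : ℕ → ℤ) : List ℤ :=
  (I.n : ℤ) :: I.target ::
    (I.players.sort (· ≥ ·)).flatMap (fun i : ℕ => [(i : ℤ), pop i])

end Instance

end Tournament

/-! ### Random access machines with bounded words and unit costs -/

namespace RAM

/-- A configuration: registers and a random access memory, holding integers. -/
structure State where
  reg : ℕ → ℤ
  mem : ℕ → ℤ

/-- Elementary instructions. The letters `d a b` are (fixed) register numbers. -/
inductive Instr where
  /-- `reg d := c` -/
  | const (d : ℕ) (c : ℤ)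
  /-- `reg d := reg a + reg b` -/
  | add (d a b : ℕ)
  /-- `reg d := reg a - reg b` -/
  | sub (d a b : ℕ)
  /-- `reg d := reg a * reg b` -/
  | mul (d a b : ℕ)
  /-- `reg d := reg a / reg b` (integer quotient, `0` if `reg b = 0`) -/
  | div (d a b : ℕ)
  /-- `reg d := mem (reg a)` -/
  | load (d a : ℕ)
  /-- `mem (reg a) := reg b` -/
  | store (a b : ℕ)

/-- Programs: elementary instructions with structured control flow. -/
inductive Prog where
  | instr (c : Instr)
  | seq (p q : Prog)
  /-- if `reg a > 0` then `p` else `q` -/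
  | branch (a : ℕ) (p q : Prog)
  /-- while `reg a > 0` do `p` -/
  | loop (a : ℕ) (p : Prog)

/-- Write `x` into register `d`; impossible if `x` does not fit into a word, that is, if
`|x| > B`. -/
def State.setReg (B : ℕ) (s : State) (d : ℕ) (x : ℤ) : Option State :=
  if x.natAbs ≤ B then some { s with reg := Function.update s.reg d x } else none

/-- The effect of an elementary instruction on a machine whose words hold the integers of absolute
value at most `B`. There is no result in case of an overflow or a negative address. -/
def Instr.apply (B : ℕ) (s : State) : Instr → Option State
  | .const d c => s.setReg B d c
  | .add d a b => s.setReg B d (s.reg a + s.reg b)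
  | .sub d a b => s.setReg B d (s.reg a - s.reg b)
  | .mul d a b => s.setReg B d (s.reg a * s.reg b)
  | .div d a b => s.setReg B d (s.reg a / s.reg b)
  | .load d a => if 0 ≤ s.reg a then s.setReg B d (s.mem (s.reg a).toNat) else none
  | .store a b =>
      if 0 ≤ s.reg a then
        some { s with mem := Function.update s.mem (s.reg a).toNat (s.reg b) }
      else none

/-- `Exec B p s t s'`: started in `s`, the program `p` halts in `s'` after exactly `t` steps, and
no value outside `[-B, B]` is ever computed. Every elementary instruction and every test is one
step. -/
inductive Exec (B : ℕ) : Prog → State → ℕ → State → Prop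
  | instr {c s s'} : c.apply B s = some s' → Exec B (.instr c) s 1 s'
  | seq {p q s s₁ s₂ t₁ t₂} :
      Exec B p s t₁ s₁ → Exec B q s₁ t₂ s₂ → Exec B (.seq p q) s (t₁ + t₂) s₂
  | branch_pos {a p q s t s'} :
      0 < s.reg a → Exec B p s t s' → Exec B (.branch a p q) s (t + 1) s'
  | branch_neg {a p q s t s'} :
      s.reg a ≤ 0 → Exec B q s t s' → Exec B (.branch a p q) s (t + 1) s'
  | loop_pos {a p s s₁ s₂ t₁ t₂} :
      0 < s.reg a → Exec B p s t₁ s₁ → Exec B (.loop a p) s₁ t₂ s₂ →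
      Exec B (.loop a p) s (t₁ + t₂ + 1) s₂
  | loop_neg {a p s} : s.reg a ≤ 0 → Exec B (.loop a p) s 1 s

/-- The initial configuration: the input stands at the beginning of the memory, and all else
is `0`. -/
def init (x : List ℤ) : State where
  reg := fun _ => 0
  mem := fun i => x.getD i 0

/-- The largest absolute value of an entry of the input. -/
def maxAbs (x : List ℤ) : ℕ := x.foldr (fun z b => max z.natAbs b) 0

end RAM

/-! ### Seedings and numbers of wins -/

namespace Tournament

/-! A game pays the popularity of its winner, so a seeding is worth the sum of `pop j` times the
number of wins of `j`, and only the win counts matter. They are realizable exactly if, among the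
players above any strength threshold, those with at least `d` wins are at most twice those with at
least `d + 1` wins, with one extra place at the top level for the champion. Necessity pairs players
with the winners of their first-round games; sufficiency uses Hall's theorem to give every
first-round loser a stronger winner (`exists_winCount`, `exists_seeding`).

If values agreed with strengths, giving many wins to strong players as early as possible would be
optimal. Otherwise a set of bad players is removed: a stack scan repeatedly discards two players
that contradict each other, and any set destroying all disagreements contains one of the two, so at
most `2 * k` players are discarded (`card_stackRun_le`). The win counts of the bad players are
guessed, with `L + 1` possibilities for each, where `n = 2 ^ L`.

For a fixed guess the levels are filled from `L` down to `0`. Everyone who entered on a higher level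
opens a slot on the current one. Scanning from the strongest player, a good player takes a slot
whenever enough remain for the later bad players guessed to have exactly this many wins. For every
realizable win sequence matching the guess, the greedy labels dominate it on every prefix and at
every level (`numGe_le_fillLevel`, `numGe_le_labels`). The totals agree and nothing changes at bad
players, so Abel summation against the nonincreasing values of the good players shows that greedy is
optimal (`labels_optimal`). Conversely, any complete labelling is realizable, so no wrong guess is
accepted falsely.

A machine program enumerates the guesses as a counter to base `L + 1` and spends `O(n * (L + 1))`
steps on each. The total is `O(n * (L + 1) ^ (2 * k + 1))`; comparing `k` with `√(L + 1)` splits the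
last factor between `k ^ O(k)` and `n ^ o(1)` (`steps_le`). -/

theorem half_lt {m : ℕ} (q : Fin (2 ^ (m + 1))) : q.1 / 2 < 2 ^ m := by
  have h : ∀ N, N = 2 ^ (m + 1) → q.1 < N := fun N hN => hN ▸ q.2
  have := h _ rfl
  have := pow_succ 2 m
  omega

/-- The winners of the first round, in the order of the leaves. -/
def roundWinners {m : ℕ} (p : Fin (2 ^ (m + 1)) → ℕ) : Fin (2 ^ m) → ℕ := fun q =>
  max (p ⟨2 * q, by have := q.2; rw [pow_succ]; omega⟩)
    (p ⟨2 * q + 1, by have := q.2; rw [pow_succ]; omega⟩)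

theorem roundWinners_firstHalf {m : ℕ} (p : Fin (2 ^ (m + 2)) → ℕ) :
    roundWinners (firstHalf p) = firstHalf (roundWinners p) := rfl

theorem roundWinners_secondHalf {m : ℕ} (p : Fin (2 ^ (m + 2)) → ℕ) :
    roundWinners (secondHalf p) = secondHalf (roundWinners p) := by
  funext q
  simp only [roundWinners, secondHalf]
  congr 2 <;> apply Fin.ext <;> simp only [pow_succ] <;> ring

/-- The definitions split the tree at the root, whereas the arguments on win counts peel off the
first round at the leaves. This and `value_succ` switch between the two recursions. -/
theorem winner_succ : ∀ (m : ℕ) (p : Fin (2 ^ (m + 1)) → ℕ),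
    winner (m + 1) p = winner m (roundWinners p)
  | 0, _ => rfl
  | m + 1, p => by
    rw [winner, winner_succ m, winner_succ m, roundWinners_firstHalf, roundWinners_secondHalf,
      winner]

theorem sum_halves {m : ℕ} (f : Fin (2 ^ (m + 1)) → ℕ) (pop : ℕ → ℤ) :
    ∑ q, pop (f q) = ∑ q, pop (firstHalf f q) + ∑ q, pop (secondHalf f q) := by
  have e : 2 ^ m + 2 ^ m = 2 ^ (m + 1) := by rw [pow_succ]; omega
  rw [← (finCongr e).sum_comp, Fin.sum_univ_add]
  rfl

theorem value_succ (pop : ℕ → ℤ) : ∀ (m : ℕ) (p : Fin (2 ^ (m + 1)) → ℕ),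
    value (fun i j _ => pop (max i j)) (m + 1) p
      = ∑ q, pop (roundWinners p q) + value (fun i j _ => pop (max i j)) m (roundWinners p)
  | 0, p => by
    simp [value, winner, roundWinners, firstHalf, secondHalf]
  | m + 1, p => by
    rw [value, value_succ pop m, value_succ pop m, winner_succ, winner_succ,
      roundWinners_firstHalf, roundWinners_secondHalf, sum_halves, value]
    ring

theorem winner_mem (S : Finset ℕ) : ∀ (m : ℕ) (p : Fin (2 ^ m) → ℕ), (∀ q, p q ∈ S) →
    winner m p ∈ S
  | 0, p, h => h 0
  | m + 1, p, h => by
    rw [winner]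
    have h1 := winner_mem S m (firstHalf p) (fun q => h _)
    have h2 := winner_mem S m (secondHalf p) (fun q => h _)
    rcases max_choice (winner m (firstHalf p)) (winner m (secondHalf p)) with h' | h' <;> rw [h']
    exacts [h1, h2]

theorem value_congr (S : Finset ℕ) {v w : ℕ → ℕ → ℕ → ℤ}
    (hvw : ∀ i ∈ S, ∀ j ∈ S, ∀ r, v i j r = w i j r) : ∀ (m : ℕ) (p : Fin (2 ^ m) → ℕ),
    (∀ q, p q ∈ S) → value v m p = value w m p
  | 0, p, h => rfl
  | m + 1, p, h => by
    rw [value, value, value_congr S hvw m (firstHalf p) (fun q => h _),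
      value_congr S hvw m (secondHalf p) (fun q => h _),
      hvw _ (winner_mem S m (firstHalf p) fun q => h _) _
        (winner_mem S m (secondHalf p) fun q => h _)]

/-- `δ` is the number of wins of the players of `S` in some knockout tournament with `m` rounds:
among the players that are at least as strong as `x`, those with at least `d + 1` wins are at
least half of those with at least `d` wins, and at most one player wins all rounds. -/
def IsWinCount (m : ℕ) (S : Finset ℕ) (δ : ℕ → ℕ) : Prop :=
  (∀ j ∈ S, δ j ≤ m) ∧ ∀ x d : ℕ, d ≤ m →
    (S.filter fun j => x ≤ j ∧ d ≤ δ j).card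
      ≤ 2 * (S.filter fun j => x ≤ j ∧ d + 1 ≤ δ j).card + if d = m then 1 else 0

/-- Start from at most one champion and descend: by the inequalities without threshold (`x = 0`),
each level down at most doubles the count. -/
theorem IsWinCount.card_le {m : ℕ} {S : Finset ℕ} {δ : ℕ → ℕ} (h : IsWinCount m S δ) :
    ∀ e ≤ m, (S.filter fun j => m - e ≤ δ j).card ≤ 2 ^ e := by
  intro e
  induction e with
  | zero =>
    intro _
    have h1 := h.2 0 m le_rfl
    have h2 : (S.filter fun j => 0 ≤ j ∧ m + 1 ≤ δ j) = ∅ := by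
      apply Finset.filter_false_of_mem
      intro j hj
      have := h.1 j hj
      omega
    rw [h2] at h1
    simpa using h1
  | succ e ih =>
    intro he
    have h1 := h.2 0 (m - (e + 1)) (by omega)
    have h2 := ih (by omega)
    rw [if_neg (by omega), show m - (e + 1) + 1 = m - e by omega] at h1
    simp only [Nat.zero_le, true_and] at h1
    rw [pow_succ]
    omega

/-- Induction on the rounds: first-round winners get one win more than in the tournament that
remains, and everyone else gets none. -/
theorem exists_winCount (pop : ℕ → ℤ) : ∀ (m : ℕ) (S : Finset ℕ) (p : Fin (2 ^ m) → ℕ),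
    Function.Injective p → Finset.univ.image p = S →
    ∃ δ, IsWinCount m S δ ∧
      ∑ j ∈ S, pop j * δ j = value (fun i j _ => pop (max i j)) m p
  | 0, S, p, hp, hS => by
    refine ⟨fun _ => 0, ⟨fun _ _ => le_rfl, fun x d hd => ?_⟩, by simp [value]⟩
    have : S.card = 1 := by rw [← hS, Finset.card_image_of_injective _ hp]; simp
    have h2 := Finset.card_filter_le S fun j => x ≤ j ∧ d ≤ 0
    simp only [Nat.le_zero.1 hd] at *
    simp only [if_true]
    omega
  | m + 1, S, p, hp, hS => by
    have hinj : Function.Injective (roundWinners p) := by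
      intro a b hab
      apply Fin.ext
      -- The winner of game `q` sits at leaf `2 * q` or `2 * q + 1`, so its leaf determines `q`.
      have key : ∀ q : Fin (2 ^ m), ∃ x : Fin (2 ^ (m + 1)),
          roundWinners p q = p x ∧ x.1 / 2 = q := by
        intro q
        unfold roundWinners
        rcases max_choice (p ⟨2 * q, by have := q.2; rw [pow_succ]; omega⟩)
          (p ⟨2 * q + 1, by have := q.2; rw [pow_succ]; omega⟩) with h' | h' <;> rw [h']
        · exact ⟨_, rfl, by simp⟩
        · exact ⟨_, rfl, by simp; omega⟩
      obtain ⟨x, hx, hx'⟩ := key a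
      obtain ⟨y, hy, hy'⟩ := key b
      have : x = y := hp (by rw [← hx, ← hy, hab])
      rw [← hx', ← hy', this]
    obtain ⟨δ, hδ, hval⟩ := exists_winCount pop m _ (roundWinners p) hinj rfl
    set S' := Finset.univ.image (roundWinners p) with hS'
    have hsub : S' ⊆ S := by
      intro j hj
      obtain ⟨q, -, rfl⟩ := Finset.mem_image.1 hj
      rw [← hS]
      unfold roundWinners
      rcases max_choice (p ⟨2 * q, by have := q.2; rw [pow_succ]; omega⟩)
          (p ⟨2 * q + 1, by have := q.2; rw [pow_succ]; omega⟩) with h' | h' <;> rw [h'] <;>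
        exact Finset.mem_image_of_mem _ (Finset.mem_univ _)
    have hfil : ∀ x d : ℕ, (S.filter fun j => x ≤ j ∧ d + 1 ≤ if j ∈ S' then δ j + 1 else 0)
        = S'.filter fun j => x ≤ j ∧ d ≤ δ j := by
      intro x d
      ext j
      simp only [Finset.mem_filter]
      by_cases hj : j ∈ S'
      · simp [hj, hsub hj]
      · simp [hj]
    refine ⟨fun j => if j ∈ S' then δ j + 1 else 0, ⟨fun j hj => ?_, fun x d hd => ?_⟩, ?_⟩
    · by_cases h : j ∈ S'
      · simpa [h] using hδ.1 j h
      · simp [h]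
    · rw [hfil]
      rcases d with _ | d
      · simp only [Nat.zero_le, and_true]
        -- Send a leaf to its first-round game. A player at least as strong as `x` plays a game
        -- whose winner is too, and each game has only two leaves.
        have hle : (S.filter fun j => x ≤ j).card
            ≤ 2 * ((Finset.univ : Finset (Fin (2 ^ m))).filter fun q => x ≤ roundWinners p q).card := by
          rw [← hS, Finset.filter_image, Finset.card_image_of_injective _ hp]
          refine Finset.card_le_mul_card_image_of_maps_to
            (f := fun q : Fin (2 ^ (m + 1)) => (⟨q.1 / 2, half_lt q⟩ : Fin (2 ^ m))) ?_ 2 ?_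
          · intro q hq
            simp only [Finset.mem_filter, Finset.mem_univ, true_and] at hq ⊢
            refine hq.trans ?_
            unfold roundWinners
            rcases Nat.mod_two_eq_zero_or_one q.1 with h | h
            · refine le_trans (le_of_eq ?_) (le_max_left _ _)
              congr 1; apply Fin.ext; simp only; omega
            · refine le_trans (le_of_eq ?_) (le_max_right _ _)
              congr 1; apply Fin.ext; simp only; omega
          · intro b _
            refine (Finset.card_le_card (t := {⟨2 * b, by have := b.2; rw [pow_succ]; omega⟩,
              ⟨2 * b + 1, by have := b.2; rw [pow_succ]; omega⟩}) ?_).trans Finset.card_le_two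
            intro q hq
            have := congrArg Fin.val (Finset.mem_filter.1 hq).2
            simp only at this
            simp only [Finset.mem_insert, Finset.mem_singleton, Fin.ext_iff]
            omega
        rw [hS', Finset.filter_image, Finset.card_image_of_injective _ hinj]
        omega
      · rw [hfil]
        have := hδ.2 x d (by omega)
        simpa using this
    · rw [value_succ, ← hval, ← Finset.sum_image (f := pop) (g := roundWinners p)
        (fun a _ b _ h => hinj h), ← hS', ← Finset.sum_add_distrib, ← Finset.sum_subset hsub]
      · refine Finset.sum_congr rfl fun j hj => ?_
        simp only [hj, if_true]
        push_cast
        ring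
      · intro j _ hj
        simp [hj]

/-- Hall's theorem. The candidate sets are nested, so the neighbourhood of a set of players contains
the candidates of its weakest member, and the threshold inequality there is Hall's condition. -/
theorem exists_injOn_le {X Y : Finset ℕ}
    (h : ∀ x, (Y.filter fun j => x ≤ j).card ≤ (X.filter fun j => x ≤ j).card) :
    ∃ f : Y → ℕ, Function.Injective f ∧ ∀ y : Y, f y ∈ X ∧ (y : ℕ) ≤ f y := by
  have := (Finset.all_card_le_biUnion_card_iff_exists_injective
    (fun y : Y => X.filter fun j => (y : ℕ) ≤ j)).1 ?_
  · obtain ⟨f, hf, hf'⟩ := this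
    exact ⟨f, hf, fun y => Finset.mem_filter.1 (hf' y)⟩
  · intro s
    rcases s.eq_empty_or_nonempty with rfl | hs
    · simp
    obtain ⟨y, hy, hmin⟩ := s.exists_min_image (fun y : Y => (y : ℕ)) hs
    calc s.card = (s.map ⟨fun y : Y => (y : ℕ), Subtype.val_injective⟩).card := by simp
      _ ≤ (Y.filter fun j => (y : ℕ) ≤ j).card := by
        refine Finset.card_le_card fun j hj => ?_
        obtain ⟨z, hz, rfl⟩ := Finset.mem_map.1 hj
        exact Finset.mem_filter.2 ⟨z.2, hmin z hz⟩
      _ ≤ _ := h y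
      _ ≤ _ := Finset.card_le_card fun j hj => Finset.mem_biUnion.2 ⟨y, hy, hj⟩

/-- The players with at least one win must be the first-round winners. They are seeded by induction
with their counts lowered by one, and each is then paired with a weaker loser. -/
theorem exists_seeding (pop : ℕ → ℤ) : ∀ (m : ℕ) (S : Finset ℕ) (δ : ℕ → ℕ), S.card = 2 ^ m →
    IsWinCount m S δ → ∃ p : Fin (2 ^ m) → ℕ, Function.Injective p ∧ (∀ q, p q ∈ S) ∧
      ∑ j ∈ S, pop j * δ j = value (fun i j _ => pop (max i j)) m p
  | 0, S, δ, hS, hδ => by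
    obtain ⟨a, rfl⟩ := Finset.card_eq_one.1 (by simpa using hS)
    refine ⟨fun _ => a, fun x y _ => ?_, by simp, ?_⟩
    · exact Subsingleton.elim (α := Fin 1) x y
    · have := hδ.1 a (by simp)
      simp [value, Nat.le_zero.1 this]
  | m + 1, S, δ, hS, hδ => by
    set S' := S.filter fun j => 1 ≤ δ j with hS'
    have hsub : S' ⊆ S := Finset.filter_subset _ _
    have hb0 : ∀ x, (S.filter fun j => x ≤ j).card ≤ 2 * (S'.filter fun j => x ≤ j).card := by
      intro x
      have := hδ.2 x 0 (by omega)
      simp only [Nat.zero_le, and_true, zero_add] at this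
      rw [hS', Finset.filter_filter]
      simpa [and_comm] using this
    -- The inequality at `d = 0` gives at least half of `S`; `IsWinCount.card_le` gives at most `2 ^
    -- m`.
    have hcard : S'.card = 2 ^ m := by
      have h1 := hb0 0
      have h2 := hδ.card_le m (by omega)
      simp only [Nat.zero_le, Finset.filter_true, hS, pow_succ] at h1
      rw [show m + 1 - m = 1 by omega] at h2
      rw [← hS'] at h2
      omega
    have hwc : IsWinCount m S' (fun j => δ j - 1) := by
      refine ⟨fun j hj => ?_, fun x d hd => ?_⟩
      · have := hδ.1 j (hsub hj)
        simp only
        omega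
      · have := hδ.2 x (d + 1) (by omega)
        have e : ∀ d, (S'.filter fun j => x ≤ j ∧ d ≤ δ j - 1)
            = S.filter fun j => x ≤ j ∧ d + 1 ≤ δ j := by
          intro d
          ext j
          simp only [hS', Finset.mem_filter]
          constructor
          · rintro ⟨⟨h1, h2⟩, h3, h4⟩; exact ⟨h1, h3, by omega⟩
          · rintro ⟨h1, h3, h4⟩; exact ⟨⟨h1, by omega⟩, h3, by omega⟩
        rw [e, e]
        simpa using this
    obtain ⟨p', hinj, hmem, hval⟩ := exists_seeding pop m S' _ hcard hwc
    have hball : ∀ x, ((S \ S').filter fun j => x ≤ j).card ≤ (S'.filter fun j => x ≤ j).card := by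
      intro x
      have h1 := hb0 x
      have h2 : ((S \ S').filter fun j => x ≤ j).card + (S'.filter fun j => x ≤ j).card
          = (S.filter fun j => x ≤ j).card := by
        rw [← Finset.card_union_of_disjoint (Finset.disjoint_filter_filter Finset.sdiff_disjoint),
          ← Finset.filter_union, Finset.sdiff_union_of_subset hsub]
      omega
    obtain ⟨f, hf, hf'⟩ := exists_injOn_le hball
    -- Losers and winners are equally many, so the matching is onto and every winner has an
    -- opponent.
    have hfimg : Finset.univ.image f = S' := by
      refine Finset.eq_of_subset_of_card_le (fun j hj => ?_) ?_
      · obtain ⟨y, -, rfl⟩ := Finset.mem_image.1 hj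
        exact (hf' y).1
      · rw [Finset.card_image_of_injective _ hf, Finset.card_univ, Fintype.card_coe,
          Finset.card_sdiff_of_subset hsub, hS, hcard, pow_succ]
        omega
    have hsurj : ∀ q, ∃ y : (S \ S' : Finset ℕ), f y = p' q := by
      intro q
      have := hmem q
      rw [← hfimg] at this
      obtain ⟨y, -, hy⟩ := Finset.mem_image.1 this
      exact ⟨y, hy⟩
    choose g hg using hsurj
    -- Winners go to the even leaves, their matched losers to the odd leaves next to them.
    let p : Fin (2 ^ (m + 1)) → ℕ := fun q =>
      if q.1 % 2 = 0 then p' ⟨q.1 / 2, half_lt q⟩ else g ⟨q.1 / 2, half_lt q⟩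
    have hrw : roundWinners p = p' := by
      funext q
      have h1 : (2 * q.1) / 2 = q.1 := by omega
      have h2 : (2 * q.1 + 1) / 2 = q.1 := by omega
      have h3 : (2 * q.1 + 1) % 2 = 1 := by omega
      have h4 := (hf' (g q)).2
      rw [hg] at h4
      simpa [roundWinners, p, h1, h2, h3] using h4
    have hgS : ∀ q, (g q : ℕ) ∈ S ∧ (g q : ℕ) ∉ S' := fun q => Finset.mem_sdiff.1 (g q).2
    refine ⟨p, ?_, ?_, ?_⟩
    · intro a b hab
      have hginj : ∀ q r, (g q : ℕ) = g r → q = r := by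
        intro q r h
        apply hinj
        rw [← hg, ← hg, Subtype.ext h]
      simp only [p] at hab
      apply Fin.ext
      split_ifs at hab with h1 h2 h2
      · have := congrArg Fin.val (hinj hab); simp only at this; omega
      · exact absurd (hab ▸ hmem _) (hgS _).2
      · exact absurd (hab.symm ▸ hmem _) (hgS _).2
      · have := congrArg Fin.val (hginj _ _ hab); simp only at this; omega
    · intro q
      simp only [p]
      split_ifs
      exacts [hsub (hmem _), (hgS _).1]
    · have himg : Finset.univ.image p' = S' := by
        refine Finset.eq_of_subset_of_card_le (fun j hj => ?_) ?_
        · obtain ⟨y, -, rfl⟩ := Finset.mem_image.1 hj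
          exact hmem y
        · rw [Finset.card_image_of_injective _ hinj, hcard]; simp
      rw [value_succ, hrw, ← hval, ← Finset.sum_image (f := pop) (g := p')
        (fun a _ b _ h => hinj h), himg, ← Finset.sum_add_distrib, ← Finset.sum_subset hsub]
      · refine Finset.sum_congr rfl fun j hj => ?_
        have : 1 ≤ δ j := (Finset.mem_filter.1 hj).2
        push_cast [Nat.cast_sub this]
        ring
      · intro j hj hj'
        have : δ j = 0 := by
          by_contra h
          exact hj' (Finset.mem_filter.2 ⟨hj, by omega⟩)
        simp [this]

theorem Instance.isYes_iff_winCount (I : Instance) (pop : ℕ → ℤ) (h : I.IsPopularityBased pop) :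
    I.IsYes ↔ ∃ δ, IsWinCount I.rounds I.players δ ∧
      I.target ≤ ∑ j ∈ I.players, pop j * δ j := by
  constructor
  · rintro ⟨σ, hσ⟩
    obtain ⟨δ, h1, h2⟩ := exists_winCount pop I.rounds I.players (fun q => (σ.symm q : ℕ))
      (fun a b hab => σ.symm.injective (Subtype.ext hab)) (by
        ext j
        simp only [Finset.mem_image, Finset.mem_univ, true_and]
        constructor
        · rintro ⟨q, rfl⟩; exact (σ.symm q).2
        · intro hj; exact ⟨σ ⟨j, hj⟩, by simp⟩)
    refine ⟨δ, h1, ?_⟩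
    rw [h2, ← value_congr I.players (fun i hi j hj r => h i hi j hj r)]
    · exact hσ
    · exact fun q => (σ.symm q).2
  · rintro ⟨δ, h1, h2⟩
    obtain ⟨p, hp, hmem, hv⟩ := exists_seeding pop I.rounds I.players δ I.card_players h1
    have hbij : Function.Bijective (fun q => (⟨p q, hmem q⟩ : I.players)) := by
      rw [Fintype.bijective_iff_injective_and_card]
      exact ⟨fun a b hab => hp (congrArg Subtype.val hab), by simp [I.card_players]⟩
    refine ⟨(Equiv.ofBijective _ hbij).symm, ?_⟩
    rw [hv, ← value_congr I.players (fun i hi j hj r => h i hi j hj r) _ _ hmem] at h2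
    exact h2

end Tournament

namespace Tournament

/-! ### Numbers of wins, listed from the strongest to the weakest player -/

/-- The number of indices below `t` where `o` is at least `d`. -/
def numGe (o : ℕ → ℕ) (d t : ℕ) : ℕ := ((Finset.range t).filter fun s => d ≤ o s).card

theorem numGe_zero (o : ℕ → ℕ) (d : ℕ) : numGe o d 0 = 0 := rfl

theorem numGe_succ (o : ℕ → ℕ) (d t : ℕ) :
    numGe o d (t + 1) = numGe o d t + if d ≤ o t then 1 else 0 := by
  unfold numGe
  rw [Finset.range_add_one, Finset.filter_insert]
  split_ifs
  · rw [Finset.card_insert_of_notMem (by simp)]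
  · rfl

theorem numGe_zero_left (o : ℕ → ℕ) (t : ℕ) : numGe o 0 t = t := by simp [numGe]

/-- `o 0, …, o (n - 1)` are the numbers of wins of the players, from the strongest to the weakest,
in some knockout tournament with `L` rounds. -/
structure IsWinSeq (n L : ℕ) (o : ℕ → ℕ) : Prop where
  le : ∀ t < n, o t ≤ L
  ballot : ∀ t ≤ n, ∀ d ≤ L, numGe o d t ≤ 2 * numGe o (d + 1) t + if d = L then 1 else 0

theorem card_filter_image {a : ℕ → ℕ} {n : ℕ} (ha : StrictAntiOn a (Set.Iio n)) {x t : ℕ}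
    (ht : t ≤ n) (hx : ∀ s < n, x ≤ a s ↔ s < t) (δ : ℕ → ℕ) (d : ℕ) :
    (((Finset.range n).image a).filter fun j => x ≤ j ∧ d ≤ δ j).card
      = numGe (fun s => δ (a s)) d t := by
  rw [Finset.filter_image, Finset.card_image_of_injOn]
  · unfold numGe
    congr 1
    ext s
    simp only [Finset.mem_filter, Finset.mem_range]
    constructor
    · rintro ⟨h1, h2, h3⟩; exact ⟨(hx s h1).1 h2, h3⟩
    · rintro ⟨h1, h2⟩; exact ⟨by omega, (hx s (by omega)).2 h1, h2⟩
  · intro s hs t ht h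
    exact ha.injOn (by simpa using (Finset.mem_filter.1 hs).1)
      (by simpa using (Finset.mem_filter.1 ht).1) h

theorem isWinCount_iff_isWinSeq {a : ℕ → ℕ} {n L : ℕ} (ha : StrictAntiOn a (Set.Iio n))
    (δ : ℕ → ℕ) :
    IsWinCount L ((Finset.range n).image a) δ ↔ IsWinSeq n L (fun s => δ (a s)) := by
  constructor
  · rintro ⟨h1, h2⟩
    refine ⟨fun t ht => h1 _ (Finset.mem_image_of_mem a (Finset.mem_range.2 ht)),
      fun t ht d hd => ?_⟩
    rcases t with _ | t
    · simp [numGe_zero]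
    · have hx : ∀ s < n, a t ≤ a s ↔ s < t + 1 := fun s hs => by
        rw [ha.le_iff_ge (show t < n by omega) hs]; omega
      have := h2 (a t) d hd
      rwa [card_filter_image ha ht hx, card_filter_image ha ht hx] at this
  · rintro ⟨h1, h2⟩
    refine ⟨fun j hj => ?_, fun x d hd => ?_⟩
    · obtain ⟨s, hs, rfl⟩ := Finset.mem_image.1 hj
      exact h1 s (Finset.mem_range.1 hs)
    -- A strength threshold cuts off a prefix of the list; it ends at the first player weaker than
    -- `x`, or at `n`.
    · have : ∃ t ≤ n, ∀ s < n, x ≤ a s ↔ s < t := by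
        by_cases h : ∃ t, t < n ∧ a t < x
        · refine ⟨Nat.find h, (Nat.find_spec h).1.le, fun s hs => ?_⟩
          constructor
          · intro hxs
            by_contra hlt
            have := (ha.le_iff_ge hs (Nat.find_spec h).1).2 (by omega)
            have := (Nat.find_spec h).2
            omega
          · intro hlt
            have := Nat.find_min h hlt
            push Not at this
            exact this hs
        · push Not at h
          exact ⟨n, le_rfl, fun s hs => by simp [hs, h s hs]⟩
      obtain ⟨t, ht, hx⟩ := this
      rw [card_filter_image ha ht hx, card_filter_image ha ht hx]
      exact h2 t ht d hd

theorem IsWinSeq.congr {n L : ℕ} {o o' : ℕ → ℕ} (h : IsWinSeq n L o) (ho : ∀ t < n, o t = o' t) :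
    IsWinSeq n L o' := by
  have : ∀ t ≤ n, ∀ d, numGe o' d t = numGe o d t := by
    intro t ht d
    unfold numGe
    congr 1
    refine Finset.filter_congr fun s hs => ?_
    rw [ho s (by have := Finset.mem_range.1 hs; omega)]
  refine ⟨fun t ht => ho t ht ▸ h.le t ht, fun t ht d hd => ?_⟩
  rw [this t ht, this t ht]
  exact h.ballot t ht d hd

/-- Counts on players and counts on positions correspond through `a`, which is injective on the
positions; a sequence is carried back along its inverse. -/
theorem exists_winCount_iff {a : ℕ → ℕ} {n L : ℕ} (ha : StrictAntiOn a (Set.Iio n))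
    (pop : ℕ → ℤ) (V : ℤ) :
    (∃ δ, IsWinCount L ((Finset.range n).image a) δ ∧
        V ≤ ∑ j ∈ (Finset.range n).image a, pop j * δ j) ↔
      ∃ o, IsWinSeq n L o ∧ V ≤ ∑ t ∈ Finset.range n, pop (a t) * o t := by
  have hinj : Set.InjOn a (Finset.range n) := by simpa using ha.injOn
  constructor
  · rintro ⟨δ, h1, h2⟩
    refine ⟨_, (isWinCount_iff_isWinSeq ha δ).1 h1, ?_⟩
    rwa [Finset.sum_image hinj] at h2
  · rintro ⟨o, h1, h2⟩
    have hinv : ∀ t < n, o (Function.invFunOn a (Finset.range n) (a t)) = o t := by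
      intro t ht
      rw [hinj.leftInvOn_invFunOn (by simpa using ht)]
    refine ⟨fun j => o (Function.invFunOn a (Finset.range n) j),
      (isWinCount_iff_isWinSeq ha _).2 (h1.congr fun t ht => (hinv t ht).symm), ?_⟩
    rw [Finset.sum_image hinj]
    refine h2.trans (le_of_eq (Finset.sum_congr rfl fun t ht => ?_))
    simp only [hinv t (Finset.mem_range.1 ht)]

/-! ### Filling up the levels greedily -/

section Level

variable (n : ℕ) (bad : Finset ℕ) (g : ℕ → ℕ) (d e : ℕ) (lab : ℕ → ℕ)

/-- `reserveAux n bad g d lab j` is the number of slots of level `d` that have to be kept for bad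
players before the last `j` players are processed. A player with positive label has entered on a
higher level and provides a slot; a bad player with `g t = d` needs a slot. -/
def reserveAux : ℕ → ℕ
  | 0 => 0
  | j + 1 =>
    if 0 < lab (n - 1 - j) then reserveAux j - 1
    else if n - 1 - j ∈ bad ∧ g (n - 1 - j) = d then reserveAux j + 1 else reserveAux j

/-- The number of slots to be kept for bad players after the first `t` players. -/
def reserve (t : ℕ) : ℕ := reserveAux n bad g d lab (n - t)

/-- With `x` open slots, player `t` enters on level `d`. -/
def Enters (x t : ℕ) : Prop :=
  lab t = 0 ∧ if t ∈ bad then g t = d ∧ 0 < x else reserve n bad g d lab (t + 1) < x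

instance (x t : ℕ) : Decidable (Enters n bad g d lab x t) := by
  unfold Enters; infer_instance

/-- The number of open slots of level `d` after the first `t` players. -/
def openSlots : ℕ → ℕ
  | 0 => e
  | t + 1 =>
    if 0 < lab t then openSlots t + 1
    else if Enters n bad g d lab (openSlots t) t then openSlots t - 1 else openSlots t

/-- The players that enter on level `d` get the label `d + 1`. -/
def fillLevel (t : ℕ) : ℕ :=
  if Enters n bad g d lab (openSlots n bad g d e lab t) t then d + 1 else lab t

theorem reserve_self : reserve n bad g d lab n = 0 := by simp [reserve, reserveAux]

theorem reserve_eq {t : ℕ} (ht : t < n) : reserve n bad g d lab t =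
    if 0 < lab t then reserve n bad g d lab (t + 1) - 1
    else if t ∈ bad ∧ g t = d then reserve n bad g d lab (t + 1) + 1
    else reserve n bad g d lab (t + 1) := by
  unfold reserve
  obtain ⟨j, hj⟩ : ∃ j, n - t = j + 1 := ⟨n - t - 1, by omega⟩
  rw [hj, reserveAux, show n - 1 - j = t by omega, show n - (t + 1) = j by omega]

variable {n bad g d e lab}

theorem Enters.pos {x t : ℕ} (h : Enters n bad g d lab x t) : 0 < x := by
  rcases h with ⟨-, h⟩
  split_ifs at h <;> omega

theorem fillLevel_of_pos {t : ℕ} (h : 0 < lab t) : fillLevel n bad g d e lab t = lab t := by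
  unfold fillLevel
  rw [if_neg]
  rintro ⟨h', -⟩
  omega

theorem fillLevel_of_zero {t : ℕ} (h : lab t = 0) : fillLevel n bad g d e lab t =
    if Enters n bad g d lab (openSlots n bad g d e lab t) t then d + 1 else 0 := by
  unfold fillLevel
  rw [h]

theorem numGe_fillLevel_of_lt (hlab : ∀ t, lab t = 0 ∨ d + 2 ≤ lab t) {c : ℕ} (hc : d + 2 ≤ c)
    (t : ℕ) : numGe (fillLevel n bad g d e lab) c t = numGe lab c t := by
  unfold numGe
  congr 1
  refine Finset.filter_congr fun s _ => ?_
  rcases hlab s with h | h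
  · rw [fillLevel_of_zero h, h]; split_ifs <;> omega
  · rw [fillLevel_of_pos (by omega)]

/-- Conservation of slots: open slots are `e` plus earlier entrants minus new entrants, while the
new count at label `d + 1` is earlier plus new entrants. No truncation occurs, since entering needs
an open slot (`Enters.pos`). The open slots are thus the slack in the inequality of `IsWinSeq` on
level `d`. -/
theorem openSlots_add (hlab : ∀ t, lab t = 0 ∨ d + 2 ≤ lab t) (t : ℕ) :
    openSlots n bad g d e lab t + numGe (fillLevel n bad g d e lab) (d + 1) t
      = 2 * numGe lab (d + 2) t + e := by
  induction t with
  | zero => simp [openSlots, numGe_zero]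
  | succ t ih =>
    rw [openSlots, numGe_succ, numGe_succ]
    rcases hlab t with h | h
    · rw [fillLevel_of_zero h, h]
      rw [if_neg (lt_irrefl 0), if_neg (show ¬ d + 2 ≤ 0 by omega)]
      by_cases h1 : Enters n bad g d lab (openSlots n bad g d e lab t) t
      · have := h1.pos
        rw [if_pos h1, if_pos h1, if_pos le_rfl]
        omega
      · rw [if_neg h1, if_neg h1, if_neg (by omega)]
        omega
    · rw [fillLevel_of_pos (by omega)]
      split_ifs <;> omega

/-- The heart of the greedy argument: domination passes from level `d + 1` to level `d`. It is
proved together with the fact that the reserve never exceeds the open slots, so that the bad players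
due on this level do find one. -/
theorem numGe_le_fillLevel {L : ℕ} {o : ℕ → ℕ} (ho : IsWinSeq n L o) (hd : d ≤ L)
    (he : e = if d = L then 1 else 0) (hg : ∀ t < n, t ∈ bad → g t = o t)
    (hlab : ∀ t, lab t = 0 ∨ d + 2 ≤ lab t)
    (hdom : ∀ t ≤ n, numGe o (d + 1) t ≤ numGe lab (d + 2) t)
    (hbad : ∀ t < n, t ∈ bad → (d + 1 ≤ o t ↔ 0 < lab t)) :
    ∀ t ≤ n, reserve n bad g d lab t ≤ openSlots n bad g d e lab t ∧
      numGe o d t ≤ numGe (fillLevel n bad g d e lab) (d + 1) t := by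
  have hmono : ∀ t, numGe o (d + 1) t ≤ numGe o d t ∧
      numGe o (d + 1) (t + 1) + numGe o d t ≤ numGe o d (t + 1) + numGe o (d + 1) t := by
    intro t
    induction t with
    | zero => simp only [numGe_succ, numGe_zero]; split_ifs <;> omega
    | succ t ih =>
      have := ih.2
      refine ⟨?_, ?_⟩
      · omega
      · rw [numGe_succ o (d + 1) (t + 1), numGe_succ o d (t + 1)]; split_ifs <;> omega
  have hball : ∀ t ≤ n, numGe o d t ≤ numGe o (d + 1) t + numGe lab (d + 2) t + e := by
    intro t ht
    have := ho.ballot t ht d hd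
    have := hdom t ht
    rw [he]
    omega
  have hres : ∀ j ≤ n, numGe o d (n - j) + reserve n bad g d lab (n - j)
      ≤ numGe o (d + 1) (n - j) + numGe lab (d + 2) (n - j) + e := by
    intro j
    induction j with
    | zero =>
      intro _
      rw [Nat.sub_zero, reserve_self]
      exact hball n le_rfl
    | succ j ih =>
      intro hj
      have ih := ih (by omega)
      obtain ⟨t, ht⟩ : ∃ t, n - (j + 1) = t := ⟨_, rfl⟩
      rw [show n - j = t + 1 by omega] at ih
      have htn : t < n := by omega
      rw [ht, reserve_eq _ _ _ _ _ htn]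
      have h1 := hball t htn.le
      have h2 := (hmono t).2
      have h3 := numGe_succ lab (d + 2) t
      split_ifs with c1 c2
      · have := hlab t
        rw [if_pos (by omega)] at h3
        omega
      · have h4 := hg t htn c2.1
        have h5 := numGe_succ o (d + 1) t
        have h6 := numGe_succ o d t
        rw [if_neg (by omega)] at h5 h3
        rw [if_pos (by omega)] at h6
        omega
      · rw [if_neg (by omega)] at h3
        omega
  intro t
  induction t with
  | zero =>
    intro _
    have := hres n le_rfl
    simp only [Nat.sub_self, numGe_zero, zero_add] at this
    simpa [numGe_zero, openSlots] using this
  | succ t ih =>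
    intro ht
    have htn : t < n := by omega
    obtain ⟨ih1, ih2⟩ := ih (by omega)
    rw [reserve_eq _ _ _ _ _ htn] at ih1
    have h1 := hres (n - (t + 1)) (by omega)
    rw [show n - (n - (t + 1)) = t + 1 by omega] at h1
    have h2 := openSlots_add (n := n) (bad := bad) (g := g) (e := e) hlab (t + 1)
    have h3 := numGe_succ (fillLevel n bad g d e lab) (d + 1) t
    have h4 := numGe_succ o d t
    by_cases c1 : 0 < lab t
    · have := hlab t
      rw [if_pos c1] at ih1
      rw [openSlots, if_pos c1]
      rw [fillLevel_of_pos c1, if_pos (by omega)] at h3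
      split_ifs at h4 <;> omega
    · rw [if_neg c1] at ih1
      have c1' : lab t = 0 := by omega
      rw [openSlots, if_neg c1] at h2 ⊢
      rw [fillLevel_of_zero c1'] at h3
      by_cases c2 : t ∈ bad
      · by_cases c3 : g t = d
        · rw [if_pos ⟨c2, c3⟩] at ih1
          have : Enters n bad g d lab (openSlots n bad g d e lab t) t :=
            ⟨c1', by rw [if_pos c2]; exact ⟨c3, by omega⟩⟩
          rw [if_pos this]
          rw [if_pos this, if_pos le_rfl] at h3
          split_ifs at h4 <;> omega
        · rw [if_neg (by tauto)] at ih1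
          have : ¬ Enters n bad g d lab (openSlots n bad g d e lab t) t := by
            rintro ⟨-, h⟩
            rw [if_pos c2] at h
            exact c3 h.1
          rw [if_neg this]
          have h5 := hg t htn c2
          have h6 := hbad t htn c2
          rw [if_neg (by omega)] at h4
          split_ifs at h3 <;> omega
      · rw [if_neg (by tauto)] at ih1
        by_cases c3 : reserve n bad g d lab (t + 1) < openSlots n bad g d e lab t
        · have : Enters n bad g d lab (openSlots n bad g d e lab t) t :=
            ⟨c1', by rwa [if_neg c2]⟩
          rw [if_pos this]
          rw [if_pos this, if_pos le_rfl] at h3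
          split_ifs at h4 <;> omega
        · have : ¬ Enters n bad g d lab (openSlots n bad g d e lab t) t := by
            rintro ⟨-, h⟩
            rw [if_neg c2] at h
            exact c3 h
          -- A good player is turned away only if the open slots do not exceed the reserve. Then
          -- `openSlots_add` and `hres` show that so many slots are already filled that `o` is
          -- dominated here.
          rw [if_neg this] at h2 ⊢
          have := hdom (t + 1) ht
          omega

variable (n bad g) in
/-- The labels after the levels `L, L - 1, …, L - j + 1` have been filled. -/
def labels (L : ℕ) : ℕ → ℕ → ℕ
  | 0 => fun _ => 0
  | j + 1 => fillLevel n bad g (L - j) (if j = 0 then 1 else 0) (labels L j)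

theorem labels_range {L : ℕ} : ∀ j ≤ L + 1, ∀ t,
    labels n bad g L j t = 0 ∨ L + 2 - j ≤ labels n bad g L j t ∧ labels n bad g L j t ≤ L + 1
  | 0, _, t => Or.inl rfl
  | j + 1, hj, t => by
    have := labels_range (L := L) j (by omega) t
    rw [labels, fillLevel]
    split_ifs <;> omega

/-- On the level just filled this is `openSlots_add` with the open slots dropped; counts on higher
levels no longer change. -/
theorem numGe_labels {L : ℕ} : ∀ j ≤ L + 1, ∀ t, ∀ d ≤ L, L + 1 - j ≤ d →
    numGe (labels n bad g L j) (d + 1) t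
      ≤ 2 * numGe (labels n bad g L j) (d + 2) t + if d = L then 1 else 0
  | 0, _, t, d, hd, hd' => by omega
  | j + 1, hj, t, d, hd, hd' => by
    have h0 : ∀ t, labels n bad g L j t = 0 ∨ L - j + 2 ≤ labels n bad g L j t := fun t => by
      have := labels_range (L := L) (n := n) (bad := bad) (g := g) j (by omega) t
      omega
    rw [labels, numGe_fillLevel_of_lt h0 (c := d + 2) (by omega)]
    rcases eq_or_ne d (L - j) with rfl | h
    · have := openSlots_add (n := n) (bad := bad) (g := g) (e := if j = 0 then 1 else 0) h0 t
      have e : (if j = 0 then 1 else 0) = if L - j = L then 1 else 0 := by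
        congr 1
        rw [eq_iff_iff]
        omega
      omega
    · rw [numGe_fillLevel_of_lt h0 (by omega)]
      exact numGe_labels j (by omega) t d hd (by omega)

/-- If everyone has entered, then the levels are the numbers of wins in some tournament. -/
theorem isWinSeq_labels {L : ℕ} (h : ∀ t < n, 0 < labels n bad g L (L + 1) t) :
    IsWinSeq n L (fun t => labels n bad g L (L + 1) t - 1) := by
  have key : ∀ t ≤ n, ∀ d, numGe (fun t => labels n bad g L (L + 1) t - 1) d t
      = numGe (labels n bad g L (L + 1)) (d + 1) t := by
    intro t ht d
    unfold numGe
    congr 1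
    refine Finset.filter_congr fun s hs => ?_
    have := h s (by have := Finset.mem_range.1 hs; omega)
    simp only
    omega
  refine ⟨fun t ht => ?_, fun t ht d hd => ?_⟩
  · have := labels_range (L := L) (n := n) (bad := bad) (g := g) (L + 1) le_rfl t
    omega
  · rw [key t ht, key t ht]
    exact numGe_labels (L + 1) le_rfl t d hd (by omega)

/-- Iterates `numGe_le_fillLevel` from the top. The second part, that bad players enter exactly on
their guessed level, is needed both for the next step and to make the difference from `o` vanish on
bad players. -/
theorem numGe_le_labels {L : ℕ} {o : ℕ → ℕ} (ho : IsWinSeq n L o)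
    (hg : ∀ t < n, t ∈ bad → g t = o t) : ∀ j ≤ L + 1,
    (∀ t ≤ n, ∀ d, L + 1 - j ≤ d → numGe o d t ≤ numGe (labels n bad g L j) (d + 1) t) ∧
    ∀ t < n, t ∈ bad → ((L + 1 - j ≤ o t ↔ 0 < labels n bad g L j t) ∧
      (0 < labels n bad g L j t → labels n bad g L j t = o t + 1))
  | 0, _ => by
    refine ⟨fun t ht d hd => ?_, fun t ht _ => ?_⟩
    · have : numGe o d t = 0 := by
        rw [numGe, Finset.card_eq_zero]
        apply Finset.filter_false_of_mem
        intro s hs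
        have := ho.le s (by have := Finset.mem_range.1 hs; omega)
        omega
      omega
    · have := ho.le t ht
      simp only [labels]
      omega
  | j + 1, hj => by
    obtain ⟨ih1, ih2⟩ := numGe_le_labels ho hg j (by omega)
    have h0 : ∀ t, labels n bad g L j t = 0 ∨ L - j + 2 ≤ labels n bad g L j t := fun t => by
      have := labels_range (L := L) (n := n) (bad := bad) (g := g) j (by omega) t
      omega
    have key := numGe_le_fillLevel (d := L - j) (e := if j = 0 then 1 else 0) ho (by omega)
      (by split_ifs <;> omega) hg h0
      (fun t ht => ih1 t ht _ (by omega)) (fun t ht hb => by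
        rw [← (ih2 t ht hb).1, show L + 1 - j = L - j + 1 by omega])
    refine ⟨fun t ht d hd => ?_, fun t ht hb => ?_⟩
    · rw [labels]
      rcases eq_or_ne d (L - j) with rfl | h
      · exact (key t ht).2
      · rw [numGe_fillLevel_of_lt h0 (by omega)]
        exact ih1 t ht d (by omega)
    · obtain ⟨h1, h2⟩ := ih2 t ht hb
      have h3 := (key t ht.le).1
      have h4 := hg t ht hb
      rw [reserve_eq _ _ _ _ _ ht] at h3
      rw [labels]
      by_cases c1 : 0 < labels n bad g L j t
      · rw [fillLevel_of_pos c1]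
        have := h2 c1
        omega
      · rw [fillLevel_of_zero (by omega)]
        rw [if_neg c1] at h3
        by_cases c2 : g t = L - j
        -- The player's own need makes the reserve positive, hence a slot is open.
        · rw [if_pos ⟨hb, c2⟩] at h3
          have : Enters n bad g (L - j) (labels n bad g L j)
              (openSlots n bad g (L - j) (if j = 0 then 1 else 0) (labels n bad g L j) t) t :=
            ⟨by omega, by rw [if_pos hb]; exact ⟨c2, by omega⟩⟩
          rw [if_pos this]
          omega
        · have : ¬ Enters n bad g (L - j) (labels n bad g L j)
              (openSlots n bad g (L - j) (if j = 0 then 1 else 0) (labels n bad g L j) t) t := by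
            rintro ⟨-, h⟩
            rw [if_pos hb] at h
            exact c2 h.1
          rw [if_neg this]
          omega

end Level

/-! ### Optimality -/

/-- Abel summation as an induction. The free lower bound `u` on the good values seen so far is what
carries it: at a good `t` the hypothesis is used with `u = v t`, the least such value, and the
prefix sum is nonnegative. -/
theorem sum_mul_nonneg_of_prefix_sums {v z : ℕ → ℤ} {good : ℕ → Prop} {n : ℕ}
    (hv : ∀ s < n, ∀ t < n, good s → good t → s < t → v t ≤ v s)
    (hz : ∀ t < n, ¬ good t → z t = 0) (hpos : ∀ t ≤ n, 0 ≤ ∑ s ∈ Finset.range t, z s) :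
    ∀ t ≤ n, ∀ u, (∀ s < t, good s → u ≤ v s) →
      u * ∑ s ∈ Finset.range t, z s ≤ ∑ s ∈ Finset.range t, v s * z s := by
  intro t
  induction t with
  | zero => simp
  | succ t ih =>
    intro ht u hu
    rw [Finset.sum_range_succ, Finset.sum_range_succ]
    by_cases hg : good t
    · have h1 := ih (by omega) (v t) fun s hs hs' => hv s (by omega) t (by omega) hs' hg hs
      have h2 := hpos (t + 1) ht
      rw [Finset.sum_range_succ] at h2
      have h3 := hu t (by omega) hg
      nlinarith
    · rw [hz t (by omega) hg]
      have := ih (by omega) u fun s hs => hu s (by omega)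
      simpa using this

theorem sum_eq_sum_numGe {o : ℕ → ℕ} {L t : ℕ} (ho : ∀ s < t, o s ≤ L) :
    ∑ s ∈ Finset.range t, o s = ∑ d ∈ Finset.range L, numGe o (d + 1) t := by
  simp only [numGe, Finset.card_filter]
  rw [Finset.sum_comm]
  refine Finset.sum_congr rfl fun s hs => ?_
  have := ho s (Finset.mem_range.1 hs)
  rw [← Finset.card_filter]
  have e : (Finset.range L).filter (fun d => d + 1 ≤ o s) = Finset.range (o s) := by
    ext d
    simp only [Finset.mem_filter, Finset.mem_range]
    omega
  rw [e, Finset.card_range]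

/-- With `2 ^ L` players all inequalities on the full list are tight: each level up keeps at least
half, and from the champion down each level at most doubles. Hence all win sequences have the same
total. -/
theorem IsWinSeq.numGe_eq {L : ℕ} {o : ℕ → ℕ} (h : IsWinSeq (2 ^ L) L o) {d : ℕ} (hd : d ≤ L) :
    numGe o d (2 ^ L) = 2 ^ (L - d) := by
  have h1 : ∀ d ≤ L, 2 ^ (L - d) ≤ numGe o d (2 ^ L) := by
    intro d
    induction d with
    | zero => intro _; simp [numGe_zero_left]
    | succ d ih =>
      intro hd
      have h1 := ih (by omega)
      have h2 := h.ballot _ le_rfl d (by omega)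
      rw [if_neg (by omega)] at h2
      rw [show L - d = L - (d + 1) + 1 by omega, pow_succ] at h1
      omega
  have h2 : ∀ e ≤ L, numGe o (L - e) (2 ^ L) ≤ 2 ^ e := by
    intro e
    induction e with
    | zero =>
      intro _
      have h2 := h.ballot _ le_rfl L le_rfl
      have h3 : numGe o (L + 1) (2 ^ L) = 0 := by
        rw [numGe, Finset.card_eq_zero]
        apply Finset.filter_false_of_mem
        intro s hs
        have := h.le s (Finset.mem_range.1 hs)
        omega
      rw [h3] at h2
      simpa using h2
    | succ e ih =>
      intro he
      have h1 := ih (by omega)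
      have h2 := h.ballot _ le_rfl (L - (e + 1)) (by omega)
      rw [if_neg (by omega), show L - (e + 1) + 1 = L - e by omega] at h2
      rw [pow_succ]
      omega
  have h3 := h2 (L - d) (by omega)
  rw [show L - (L - d) = d by omega] at h3
  exact le_antisymm h3 (h1 d hd)

theorem labels_optimal {L : ℕ} {bad : Finset ℕ} {g o : ℕ → ℕ} {v : ℕ → ℤ}
    (hv : ∀ s < 2 ^ L, ∀ t < 2 ^ L, s ∉ bad → t ∉ bad → s < t → v t ≤ v s)
    (ho : IsWinSeq (2 ^ L) L o) (hg : ∀ t < 2 ^ L, t ∈ bad → g t = o t) :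
    (∀ t < 2 ^ L, 0 < labels (2 ^ L) bad g L (L + 1) t) ∧
    ∑ t ∈ Finset.range (2 ^ L), v t * o t
      ≤ ∑ t ∈ Finset.range (2 ^ L), v t * (labels (2 ^ L) bad g L (L + 1) t - 1 : ℕ) := by
  obtain ⟨h1, h2⟩ := numGe_le_labels ho hg (L + 1) le_rfl
  set n := 2 ^ L with hn
  have hall : ∀ t < n, 0 < labels n bad g L (L + 1) t := by
    -- Domination on level `0` over the full list: all `n` players count in `o`, so all have
    -- entered.
    have h3 := h1 n le_rfl 0 (by omega)
    rw [numGe_zero_left, numGe] at h3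
    have h4 := Finset.eq_of_subset_of_card_le (Finset.filter_subset _ (Finset.range n))
      (by rwa [Finset.card_range])
    intro t ht
    have := h4.symm ▸ Finset.mem_range.2 ht
    exact (Finset.mem_filter.1 this).2
  refine ⟨hall, ?_⟩
  have hwin := isWinSeq_labels hall
  set q : ℕ → ℕ := fun t => labels n bad g L (L + 1) t - 1 with hq
  have hnum : ∀ t ≤ n, ∀ d, numGe o d t ≤ numGe q d t := by
    intro t ht d
    refine (h1 t ht d (by omega)).trans (le_of_eq ?_)
    unfold numGe
    congr 1
    refine Finset.filter_congr fun s hs => ?_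
    have := hall s (by have := Finset.mem_range.1 hs; omega)
    simp only [hq]
    omega
  have hsum : ∀ t ≤ n, ∑ s ∈ Finset.range t, o s ≤ ∑ s ∈ Finset.range t, q s := by
    intro t ht
    rw [sum_eq_sum_numGe fun s hs => ho.le s (by omega),
      sum_eq_sum_numGe fun s hs => hwin.le s (by omega)]
    exact Finset.sum_le_sum fun d _ => hnum t ht _
  have htot : ∑ s ∈ Finset.range n, o s = ∑ s ∈ Finset.range n, q s := by
    rw [sum_eq_sum_numGe fun s hs => ho.le s (by omega),
      sum_eq_sum_numGe fun s hs => hwin.le s (by omega)]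
    refine Finset.sum_congr rfl fun d hd => ?_
    have := Finset.mem_range.1 hd
    rw [ho.numGe_eq (by omega), hwin.numGe_eq (by omega)]
  have key := sum_mul_nonneg_of_prefix_sums (v := v) (z := fun t => (q t : ℤ) - o t)
    (good := fun t => t ∉ bad) (n := n) hv (fun t ht hb => by
      have := (h2 t ht (not_not.1 hb)).2 (hall t ht)
      simp only [hq]
      omega) (fun t ht => by
      rw [Finset.sum_sub_distrib, sub_nonneg]
      exact_mod_cast hsum t ht) n le_rfl
  -- Any lower bound will do, because it is multiplied by the total difference, which is zero.
  have hu : ∃ u, ∀ s < n, s ∉ bad → u ≤ v s := by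
    refine ⟨-∑ s ∈ Finset.range n, |v s|, fun s hs _ => ?_⟩
    have := Finset.single_le_sum (f := fun s => |v s|) (fun _ _ => abs_nonneg _)
      (Finset.mem_range.2 hs)
    have := neg_abs_le (v s)
    linarith
  obtain ⟨u, hu⟩ := hu
  have h5 := key u hu
  have h6 : ∑ s ∈ Finset.range n, ((q s : ℤ) - o s) = 0 := by
    rw [Finset.sum_sub_distrib, sub_eq_zero]
    exact_mod_cast htot.symm
  rw [h6, mul_zero] at h5
  simp only [mul_sub, Finset.sum_sub_distrib] at h5
  linarith

end Tournament

namespace Tournament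

/-! ### Finding a small set of bad players -/

/-- Process player `i`: if its value exceeds that of the player on top of the stack, then both are
bad; otherwise push it. -/
def stackStep (v : ℕ → ℤ) (i : ℕ) : List ℕ × Finset ℕ → List ℕ × Finset ℕ
  | ([], bad) => ([i], bad)
  | (a :: st, bad) => if v a < v i then (st, insert a (insert i bad)) else (i :: a :: st, bad)

/-- The stack and the bad players after the first `i` players have been processed. -/
def stackRun (v : ℕ → ℤ) : ℕ → List ℕ × Finset ℕ
  | 0 => ([], ∅)
  | i + 1 => stackStep v i (stackRun v i)

/-- What is known after the first `i` players: the stack holds those that are not bad, their values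
agree with the strengths, and every set that destroys all disagreements contains at least half of
the bad players. -/
structure StackInv (v : ℕ → ℤ) (i : ℕ) (st : List ℕ) (bad : Finset ℕ) : Prop where
  sorted : st.Pairwise (· > ·)
  mem_iff : ∀ t, t ∈ st ↔ t < i ∧ t ∉ bad
  lt : ∀ t ∈ bad, t < i
  anti : ∀ s ∈ st, ∀ t ∈ st, s < t → v t ≤ v s
  card_le : ∀ X : Finset ℕ, (∀ s < i, ∀ t < i, s ∉ X → t ∉ X → s < t → v t ≤ v s) →
    bad.card ≤ 2 * (bad ∩ X).card

/-- The top of the stack is its weakest player and has the least value, so comparing with the top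
suffices. If the two clash, both were not bad before and any admissible `X` contains one of them, so
the two sides of `card_le` grow by two and by at least two. -/
theorem StackInv.step {v : ℕ → ℤ} {i : ℕ} {st : List ℕ} {bad : Finset ℕ}
    (h : StackInv v i st bad) :
    StackInv v (i + 1) (stackStep v i (st, bad)).1 (stackStep v i (st, bad)).2 := by
  have hi : i ∉ bad := fun hi => lt_irrefl _ (h.lt i hi)
  have hcard : ∀ X : Finset ℕ, (∀ s < i + 1, ∀ t < i + 1, s ∉ X → t ∉ X → s < t → v t ≤ v s) →
      bad.card ≤ 2 * (bad ∩ X).card := fun X hX =>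
    h.card_le X fun s hs t ht => hX s (by omega) t (by omega)
  have hpush : ∀ st', st' = st → (∀ a ∈ st, v i ≤ v a) → StackInv v (i + 1) (i :: st') bad := by
    rintro st' rfl ha
    refine ⟨?_, fun t => ?_, fun t ht => (h.lt t ht).trans (Nat.lt_succ_self i), ?_, hcard⟩
    · rw [List.pairwise_cons]
      exact ⟨fun t ht => ((h.mem_iff t).1 ht).1, h.sorted⟩
    · rw [List.mem_cons, h.mem_iff]
      constructor
      · rintro (rfl | ⟨h1, h2⟩)
        exacts [⟨by omega, hi⟩, ⟨by omega, h2⟩]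
      · rintro ⟨h1, h2⟩
        rcases Nat.lt_succ_iff_lt_or_eq.1 h1 with h3 | h3
        exacts [Or.inr ⟨h3, h2⟩, Or.inl h3]
    · intro s hs t ht hst
      rcases List.mem_cons.1 hs with rfl | hs' <;> rcases List.mem_cons.1 ht with rfl | ht'
      · omega
      · have := ((h.mem_iff t).1 ht').1; omega
      · exact ha s hs'
      · exact h.anti s hs' t ht' hst
  rcases st with _ | ⟨a, st⟩
  · exact hpush [] rfl (by simp)
  · have hsort := List.pairwise_cons.1 h.sorted
    have ha := (h.mem_iff a).1 (by simp)
    by_cases hlt : v a < v i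
    · rw [stackStep, if_pos hlt]
      refine ⟨hsort.2, fun t => ?_, fun t ht => ?_, fun s hs t ht => h.anti s (by simp [hs]) t
        (by simp [ht]), fun X hX => ?_⟩
      · have h1 := h.mem_iff t
        rw [List.mem_cons] at h1
        simp only [Finset.mem_insert, not_or]
        constructor
        · intro ht
          have h2 := h1.1 (Or.inr ht)
          have h3 := hsort.1 t ht
          exact ⟨by omega, by omega, by omega, h2.2⟩
        · rintro ⟨h2, h3, h4, h5⟩
          exact (h1.2 ⟨by omega, h5⟩).resolve_left h3
      · simp only [Finset.mem_insert] at ht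
        rcases ht with rfl | rfl | ht
        · omega
        · omega
        · have := h.lt t ht; omega
      · have h1 := hcard X hX
        have h2 : a ∈ X ∨ i ∈ X := by
          by_contra hcon
          push Not at hcon
          have := hX a (by omega) i (by omega) hcon.1 hcon.2 ha.1
          omega
        have h3 : a ∉ insert i bad := by
          rw [Finset.mem_insert]
          rintro (h | h)
          · omega
          · exact ha.2 h
        change (insert a (insert i bad)).card ≤ 2 * (insert a (insert i bad) ∩ X).card
        rw [Finset.card_insert_of_notMem h3, Finset.card_insert_of_notMem hi]
        have h4 : (bad ∩ X).card + 1 ≤ (insert a (insert i bad) ∩ X).card := by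
          rcases h2 with h2 | h2
          · rw [← Finset.card_insert_of_notMem (s := bad ∩ X) (a := a)
              (fun h => ha.2 (Finset.mem_inter.1 h).1)]
            refine Finset.card_le_card fun t ht => ?_
            rcases Finset.mem_insert.1 ht with rfl | ht
            · simp [h2]
            · have := Finset.mem_inter.1 ht
              simp [this]
          · rw [← Finset.card_insert_of_notMem (s := bad ∩ X) (a := i)
              (fun h => hi (Finset.mem_inter.1 h).1)]
            refine Finset.card_le_card fun t ht => ?_
            rcases Finset.mem_insert.1 ht with rfl | ht
            · simp [h2]
            · have := Finset.mem_inter.1 ht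
              simp [this]
        omega
    · rw [stackStep, if_neg hlt]
      refine hpush _ rfl fun b hb => ?_
      rcases List.mem_cons.1 hb with rfl | hb'
      · omega
      · have := h.anti b (by simp [hb']) a (by simp) (hsort.1 b hb')
        omega

theorem stackInv (v : ℕ → ℤ) : ∀ i, StackInv v i (stackRun v i).1 (stackRun v i).2
  | 0 => ⟨by simp [stackRun], by simp [stackRun], by simp [stackRun], by simp [stackRun],
      by simp [stackRun]⟩
  | i + 1 => (stackInv v i).step

theorem stackRun_anti (v : ℕ → ℤ) {n s t : ℕ} (hs : s < n) (ht : t < n)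
    (hs' : s ∉ (stackRun v n).2) (ht' : t ∉ (stackRun v n).2) (hst : s < t) : v t ≤ v s :=
  (stackInv v n).anti s (((stackInv v n).mem_iff s).2 ⟨hs, hs'⟩) t
    (((stackInv v n).mem_iff t).2 ⟨ht, ht'⟩) hst

theorem card_stackRun_le (I : Instance) {pop : ℕ → ℤ} {a : ℕ → ℕ} {n : ℕ}
    (ha : StrictAntiOn a (Set.Iio n)) (hI : I.players = (Finset.range n).image a) :
    (stackRun (fun t => pop (a t)) n).2.card ≤ 2 * I.disagreement pop := by
  have hne : {k : ℕ | ∃ N' ⊆ I.players, N'.card ≤ k ∧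
      Instance.AgreeOn pop (I.players \ N')}.Nonempty :=
    ⟨_, I.players, subset_rfl, le_rfl, by simp [Instance.AgreeOn]⟩
  obtain ⟨N', h1, h2, h3⟩ := Nat.sInf_mem hne
  change N'.card ≤ I.disagreement pop at h2
  refine ((stackInv _ n).card_le ((Finset.range n).filter fun t => a t ∈ N') ?_).trans ?_
  · intro s hs t ht hs' ht' hst
    simp only [Finset.mem_filter, Finset.mem_range, hs, ht, true_and] at hs' ht'
    refine h3 _ (Finset.mem_sdiff.2 ⟨?_, hs'⟩) _ (Finset.mem_sdiff.2 ⟨?_, ht'⟩) (ha hs ht hst)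
    · rw [hI]; exact Finset.mem_image_of_mem a (Finset.mem_range.2 hs)
    · rw [hI]; exact Finset.mem_image_of_mem a (Finset.mem_range.2 ht)
  · refine Nat.mul_le_mul_left 2 (le_trans (le_trans (Finset.card_le_card
      Finset.inter_subset_right) ?_) h2)
    refine Finset.card_le_card_of_injOn a (fun t ht => (Finset.mem_filter.1 ht).2) ?_
    intro s hs t ht h
    exact ha.injOn (by simpa using (Finset.mem_filter.1 hs).1)
      (by simpa using (Finset.mem_filter.1 ht).1) h

/-! ### Enumerating the numbers of wins of the bad players -/

/-- The quotient of `j` after division by `K` for every bad player below `i`. -/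
def quotient (K : ℕ) (bad : Finset ℕ) (j : ℕ) : ℕ → ℕ
  | 0 => j
  | i + 1 => if i ∈ bad then quotient K bad j i / K else quotient K bad j i

/-- The digits of `j` to base `K`, distributed to the bad players. -/
def digit (K : ℕ) (bad : Finset ℕ) (j i : ℕ) : ℕ :=
  if i ∈ bad then quotient K bad j i % K else 0

/-- The difference of the quotients is the carry when the counter is incremented, so it is `0` or
`1`; the machine keeps it in register `7`. -/
theorem quotient_succ_left {K : ℕ} (hK : 0 < K) (bad : Finset ℕ) (j : ℕ) : ∀ i,
    quotient K bad (j + 1) i = quotient K bad j i ∨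
      quotient K bad (j + 1) i = quotient K bad j i + 1
  | 0 => Or.inr rfl
  | i + 1 => by
    rw [quotient, quotient]
    split_ifs
    · rcases quotient_succ_left hK bad j i with h | h <;> rw [h]
      · simp
      · rw [Nat.succ_div]; split_ifs <;> simp
    · exact quotient_succ_left hK bad j i

theorem digit_succ_of_eq {K : ℕ} {bad : Finset ℕ} {j i : ℕ}
    (h : quotient K bad (j + 1) i = quotient K bad j i) :
    digit K bad (j + 1) i = digit K bad j i ∧
      quotient K bad (j + 1) (i + 1) = quotient K bad j (i + 1) := by
  rw [digit, digit, quotient, quotient, h]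
  exact ⟨rfl, rfl⟩

theorem digit_succ_of_lt {K : ℕ} {bad : Finset ℕ} {j i : ℕ} (hi : i ∈ bad)
    (h : quotient K bad (j + 1) i = quotient K bad j i + 1) (hlt : digit K bad j i + 1 < K) :
    digit K bad (j + 1) i = digit K bad j i + 1 ∧
      quotient K bad (j + 1) (i + 1) = quotient K bad j (i + 1) := by
  rw [digit, if_pos hi] at hlt
  rw [digit, digit, quotient, quotient, h, if_pos hi, if_pos hi, if_pos hi, if_pos hi]
  have h1 := Nat.div_add_mod (quotient K bad j i) K
  generalize quotient K bad j i = q at *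
  have h2 : q + 1 = (q % K + 1) + K * (q / K) := by omega
  constructor
  · rw [h2, Nat.add_mul_mod_self_left, Nat.mod_eq_of_lt hlt]
  · conv_lhs => rw [h2, Nat.add_mul_div_left _ _ (by omega), Nat.div_eq_of_lt hlt, zero_add]

theorem digit_succ_of_eq_base {K : ℕ} {bad : Finset ℕ} {j i : ℕ} (hi : i ∈ bad)
    (h : quotient K bad (j + 1) i = quotient K bad j i + 1) (hK : digit K bad j i + 1 = K) :
    digit K bad (j + 1) i = 0 ∧
      quotient K bad (j + 1) (i + 1) = quotient K bad j (i + 1) + 1 := by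
  rw [digit, if_pos hi] at hK
  rw [digit, quotient, quotient, h, if_pos hi, if_pos hi, if_pos hi]
  have h1 := Nat.div_add_mod (quotient K bad j i) K
  generalize quotient K bad j i = q at *
  have h2 : q + 1 = K * (q / K + 1) := by rw [mul_add]; omega
  constructor
  · rw [h2, Nat.mul_mod_right]
  · conv_lhs => rw [h2, Nat.mul_div_cancel_left _ (by omega)]

theorem quotient_eq_div (K : ℕ) (bad : Finset ℕ) (j : ℕ) : ∀ i,
    quotient K bad j i = j / K ^ (bad.filter (· < i)).card
  | 0 => by simp [quotient]
  | i + 1 => by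
    rw [quotient, quotient_eq_div K bad j i]
    have : bad.filter (· < i + 1)
        = if i ∈ bad then insert i (bad.filter (· < i)) else bad.filter (· < i) := by
      ext t
      split_ifs with h
      · simp only [Finset.mem_filter, Finset.mem_insert]
        constructor
        · rintro ⟨h1, h2⟩
          rcases Nat.lt_succ_iff_lt_or_eq.1 h2 with h3 | h3
          exacts [Or.inr ⟨h1, h3⟩, Or.inl h3]
        · rintro (rfl | ⟨h1, h2⟩)
          exacts [⟨h, by omega⟩, ⟨h1, by omega⟩]
      · simp only [Finset.mem_filter]
        constructor
        · rintro ⟨h1, h2⟩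
          rcases Nat.lt_succ_iff_lt_or_eq.1 h2 with h3 | h3
          exacts [⟨h1, h3⟩, absurd (h3 ▸ h1) h]
        · rintro ⟨h1, h2⟩
          exact ⟨h1, by omega⟩
    rw [this]
    split_ifs with h
    · rw [Finset.card_insert_of_notMem (by simp), pow_succ, Nat.div_div_eq_div_mul]
    · rfl

theorem quotient_of_subset {K n : ℕ} {bad : Finset ℕ} (hbad : ∀ t ∈ bad, t < n) (j : ℕ) :
    quotient K bad j n = j / K ^ bad.card := by
  rw [quotient_eq_div, Finset.filter_true_of_mem hbad]

theorem exists_digit_eq {K n : ℕ} {bad : Finset ℕ} (hbad : ∀ t ∈ bad, t < n) {o : ℕ → ℕ}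
    (ho : ∀ t ∈ bad, o t < K) (hK : 0 < K) :
    ∃ j < K ^ bad.card, ∀ t ∈ bad, digit K bad j t = o t := by
  -- Horner's scheme from the last digit backwards: `q` is the quotient that must arrive at position
  -- `n - i` to produce the remaining digits and leave `0`.
  have key : ∀ i ≤ n, ∃ q, ∀ j, quotient K bad j (n - i) = q →
      quotient K bad j n = 0 ∧ ∀ t ∈ bad, n - i ≤ t → digit K bad j t = o t := by
    intro i
    induction i with
    | zero =>
      intro _
      refine ⟨0, fun j hj => ⟨hj, fun t ht h => ?_⟩⟩
      have := hbad t ht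
      omega
    | succ i ih =>
      intro hi
      obtain ⟨q, hq⟩ := ih (by omega)
      have e : n - i = n - (i + 1) + 1 := by omega
      by_cases hb : n - (i + 1) ∈ bad
      · have hlt := ho _ hb
        refine ⟨q * K + o (n - (i + 1)), fun j hj => ?_⟩
        have h1 : quotient K bad j (n - i) = q := by
          rw [e, quotient, if_pos hb, hj, mul_comm, Nat.mul_add_div hK, Nat.div_eq_of_lt hlt,
            add_zero]
        refine ⟨(hq j h1).1, fun t ht hle => ?_⟩
        rcases Nat.eq_or_lt_of_le hle with rfl | hlt'
        · rw [digit, if_pos hb, hj, mul_comm, Nat.mul_add_mod, Nat.mod_eq_of_lt hlt]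
        · exact (hq j h1).2 t ht (by omega)
      · refine ⟨q, fun j hj => ?_⟩
        have h1 : quotient K bad j (n - i) = q := by
          rw [e, quotient, if_neg hb, hj]
        refine ⟨(hq j h1).1, fun t ht hle => ?_⟩
        rcases Nat.eq_or_lt_of_le hle with rfl | hlt'
        · exact absurd ht hb
        · exact (hq j h1).2 t ht (by omega)
  obtain ⟨j, hj⟩ := key n le_rfl
  have h := hj j (by rw [Nat.sub_self]; rfl)
  refine ⟨j, ?_, fun t ht => h.2 t ht (by omega)⟩
  rw [quotient_of_subset hbad] at h
  exact Nat.lt_of_div_eq_zero (pow_pos hK _) h.1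

/-! ### Correctness of the enumeration -/

/-- The number of players with positive label. -/
def labelCount (n : ℕ) (lab : ℕ → ℕ) : ℕ := ((Finset.range n).filter fun t => 0 < lab t).card

/-- The sum of the popularity values, multiplied by the levels. -/
def labelSum (n : ℕ) (v : ℕ → ℤ) (lab : ℕ → ℕ) : ℤ :=
  ∑ t ∈ Finset.range n, v t * (lab t - 1 : ℕ)

/-- The test for the `j`-th guess of the numbers of wins of the bad players. -/
def Accepts (L : ℕ) (bad : Finset ℕ) (v : ℕ → ℤ) (V : ℤ) (j : ℕ) : Prop :=
  2 ^ L ≤ labelCount (2 ^ L) (labels (2 ^ L) bad (digit (L + 1) bad j) L (L + 1)) ∧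
    V ≤ labelSum (2 ^ L) v (labels (2 ^ L) bad (digit (L + 1) bad j) L (L + 1))

theorem le_labelCount_iff {n : ℕ} {lab : ℕ → ℕ} :
    n ≤ labelCount n lab ↔ ∀ t < n, 0 < lab t := by
  unfold labelCount
  constructor
  · intro h t ht
    have := Finset.eq_of_subset_of_card_le (Finset.filter_subset _ (Finset.range n))
      (by rwa [Finset.card_range])
    have := this.symm ▸ Finset.mem_range.2 ht
    exact (Finset.mem_filter.1 this).2
  · intro h
    rw [Finset.filter_true_of_mem fun t ht => h t (Finset.mem_range.1 ht), Finset.card_range]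

/-- Completeness takes the guess that agrees with `o` on the bad players and uses optimality.
Soundness needs nothing about the guess: any complete labelling is itself a win sequence. -/
theorem exists_winSeq_iff_accepts {L : ℕ} {v : ℕ → ℤ} {V : ℤ} {bad : Finset ℕ}
    (hbad : ∀ t ∈ bad, t < 2 ^ L)
    (hv : ∀ s < 2 ^ L, ∀ t < 2 ^ L, s ∉ bad → t ∉ bad → s < t → v t ≤ v s) :
    (∃ o, IsWinSeq (2 ^ L) L o ∧ V ≤ ∑ t ∈ Finset.range (2 ^ L), v t * o t) ↔
      ∃ j < (L + 1) ^ bad.card, Accepts L bad v V j := by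
  constructor
  · rintro ⟨o, ho, hV⟩
    obtain ⟨j, hj, hd⟩ := exists_digit_eq (K := L + 1) hbad
      (fun t ht => Nat.lt_succ_of_le (ho.le t (hbad t ht))) (Nat.succ_pos L)
    obtain ⟨h1, h2⟩ := labels_optimal hv ho fun t _ hb => hd t hb
    exact ⟨j, hj, le_labelCount_iff.2 h1, hV.trans h2⟩
  · rintro ⟨j, -, h1, h2⟩
    exact ⟨_, isWinSeq_labels (le_labelCount_iff.1 h1), h2⟩

end Tournament

namespace RAM

/-! ### Weakest preconditions -/

def State.set (s : State) (d : ℕ) (x : ℤ) : State := { s with reg := Function.update s.reg d x }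

def State.put (s : State) (a : ℕ) (x : ℤ) : State := { s with mem := Function.update s.mem a x }

theorem State.set_reg (s : State) (d : ℕ) (x : ℤ) (e : ℕ) :
    (s.set d x).reg e = if e = d then x else s.reg e := by
  simp [State.set, Function.update_apply]

theorem State.set_mem (s : State) (d : ℕ) (x : ℤ) : (s.set d x).mem = s.mem := rfl

theorem State.put_reg (s : State) (a : ℕ) (x : ℤ) : (s.put a x).reg = s.reg := rfl

theorem State.put_mem (s : State) (a : ℕ) (x : ℤ) (b : ℕ) :
    (s.put a x).mem b = if b = a then x else s.mem b := by
  simp [State.put, Function.update_apply]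

/-- Started in `s`, the program halts after at most `T` steps in a state that satisfies `Q`. -/
def Runs (B : ℕ) (p : Prog) (T : ℕ) (Q : State → Prop) (s : State) : Prop :=
  ∃ t s', Exec B p s t s' ∧ t ≤ T ∧ Q s'

theorem Runs.mono {B : ℕ} {p : Prog} {T T' : ℕ} {Q Q' : State → Prop} {s : State}
    (h : Runs B p T Q s) (hT : T ≤ T') (hQ : ∀ s, Q s → Q' s) : Runs B p T' Q' s := by
  obtain ⟨t, s', h1, h2, h3⟩ := h
  exact ⟨t, s', h1, h2.trans hT, hQ _ h3⟩

theorem Runs.seq {B : ℕ} {p q : Prog} {T₁ T₂ : ℕ} {Q R : State → Prop} {s : State}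
    (hp : Runs B p T₁ R s) (hq : ∀ s, R s → Runs B q T₂ Q s) :
    Runs B (.seq p q) (T₁ + T₂) Q s := by
  obtain ⟨t, s', h1, h2, h3⟩ := hp
  obtain ⟨t', s'', h1', h2', h3'⟩ := hq s' h3
  exact ⟨_, s'', .seq h1 h1', by omega, h3'⟩

/-- The number of iterations is known in advance, so the index of the invariant also proves
termination. Each `+ 1` accounts for a test. -/
theorem Runs.loop {B a : ℕ} {p : Prog} {T N : ℕ} {Inv : ℕ → State → Prop}
    (hpos : ∀ j < N, ∀ s, Inv j s → 0 < s.reg a ∧ Runs B p T (Inv (j + 1)) s)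
    (hend : ∀ s, Inv N s → s.reg a ≤ 0) {s : State} (h : Inv 0 s) :
    Runs B (.loop a p) (N * (T + 1) + 1) (Inv N) s := by
  have key : ∀ i ≤ N, ∀ s, Inv (N - i) s → Runs B (.loop a p) (i * (T + 1) + 1) (Inv N) s := by
    intro i
    induction i with
    | zero =>
      intro _ s hs
      exact ⟨1, s, .loop_neg (hend s hs), by omega, hs⟩
    | succ i ih =>
      intro hi s hs
      obtain ⟨h1, t, s', h2, h3, h4⟩ := hpos _ (by omega) s hs
      rw [show N - (i + 1) + 1 = N - i by omega] at h4
      obtain ⟨t', s'', h5, h6, h7⟩ := ih (by omega) s' h4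
      refine ⟨_, s'', .loop_pos h1 h2 h5, ?_, h7⟩
      rw [add_mul]
      omega
  exact key N le_rfl s (by rwa [Nat.sub_self])

/-- The weakest precondition of an elementary instruction. -/
def Instr.wp (B : ℕ) (Q : State → Prop) (s : State) : Instr → Prop
  | .const d c => c.natAbs ≤ B ∧ Q (s.set d c)
  | .add d a b => (s.reg a + s.reg b).natAbs ≤ B ∧ Q (s.set d (s.reg a + s.reg b))
  | .sub d a b => (s.reg a - s.reg b).natAbs ≤ B ∧ Q (s.set d (s.reg a - s.reg b))
  | .mul d a b => (s.reg a * s.reg b).natAbs ≤ B ∧ Q (s.set d (s.reg a * s.reg b))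
  | .div d a b => (s.reg a / s.reg b).natAbs ≤ B ∧ Q (s.set d (s.reg a / s.reg b))
  | .load d a => 0 ≤ s.reg a ∧ (s.mem (s.reg a).toNat).natAbs ≤ B ∧
      Q (s.set d (s.mem (s.reg a).toNat))
  | .store a b => 0 ≤ s.reg a ∧ Q (s.put (s.reg a).toNat (s.reg b))

/-- A sufficient precondition of a program without loops. -/
def Prog.wp (B : ℕ) : Prog → (State → Prop) → State → Prop
  | .instr c, Q, s => c.wp B Q s
  | .seq p q, Q, s => p.wp B (q.wp B Q) s
  | .branch a p q, Q, s => (0 < s.reg a → p.wp B Q s) ∧ (s.reg a ≤ 0 → q.wp B Q s)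
  | .loop _ _, _, _ => False

/-- An upper bound for the number of steps of a program without loops. -/
def Prog.cost : Prog → ℕ
  | .instr _ => 1
  | .seq p q => p.cost + q.cost
  | .branch _ p q => max p.cost q.cost + 1
  | .loop _ _ => 0

theorem Instr.runs_of_wp {B : ℕ} {c : Instr} {Q : State → Prop} {s : State} (h : c.wp B Q s) :
    Runs B (.instr c) 1 Q s := by
  cases c <;> simp only [Instr.wp] at h
  case load => exact ⟨1, _, .instr (by
    simp only [Instr.apply, State.setReg, if_pos h.1, if_pos h.2.1]; rfl), le_rfl, h.2.2⟩
  case store => exact ⟨1, _, .instr (by simp only [Instr.apply, if_pos h.1]; rfl), le_rfl, h.2⟩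
  all_goals exact ⟨1, _, .instr (by simp only [Instr.apply, State.setReg, if_pos h.1]; rfl),
    le_rfl, h.2⟩

/-- A loop has precondition `False`, so its fictitious cost `0` does no harm. -/
theorem Prog.runs_of_wp {B : ℕ} : ∀ {p : Prog} {Q : State → Prop} {s : State}, p.wp B Q s →
    Runs B p p.cost Q s
  | .instr c, Q, s, h => Instr.runs_of_wp h
  | .seq p q, Q, s, h => Runs.seq (Prog.runs_of_wp (p := p) h) fun _ hs => Prog.runs_of_wp hs
  | .branch a p q, Q, s, h => by
    by_cases ha : 0 < s.reg a
    · obtain ⟨t, s', h1, h2, h3⟩ := Prog.runs_of_wp (h.1 ha)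
      exact ⟨_, s', .branch_pos ha h1, by simp only [Prog.cost]; omega, h3⟩
    · obtain ⟨t, s', h1, h2, h3⟩ := Prog.runs_of_wp (h.2 (not_lt.1 ha))
      exact ⟨_, s', .branch_neg (not_lt.1 ha) h1, by simp only [Prog.cost]; omega, h3⟩

theorem Prog.runs_seq_of_wp {B : ℕ} {p q : Prog} {T : ℕ} {Q : State → Prop} {s : State}
    (h : p.wp B (Runs B q T Q) s) : Runs B (.seq p q) (p.cost + T) Q s :=
  Runs.seq (Prog.runs_of_wp h) fun _ hs => hs

/-- Run the programs of a list, one after the other. -/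
def Prog.list : List Prog → Prog
  | [] => .instr (.const 6 0)
  | [p] => p
  | p :: q :: l => .seq p (Prog.list (q :: l))

end RAM

namespace Tournament

open RAM RAM.Instr RAM.Prog

/-! ### The program

Registers: `0` answer, `1` number of players, `2` target, `3` number of rounds `L`, `4` end of
the input, `5` one, `6` zero, `7` whether the enumeration goes on, `8` level, `9` open slots, or
slots to be kept, or height of the stack, `10` number of players that have entered, `11` value,
`12` and `13` pointers, `14` and `15` loop counters, `16` open slots initially, `17` to `22`
temporary, `23` two, `24` three.

Memory: for player `i`, the cell `2 * i + 2` tells whether it is bad, `2 * i + 3` holds its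
popularity value, and the cells from `2 * n + 2 + 3 * i` hold its guessed number of wins, its
label and the number of slots to be kept (at first, this is the place of the stack). -/

/-- Register `6` holds zero throughout, so this leaves the state as it is and costs one step. -/
def skip : Prog := .instr (.const 6 0)

/-- Compute the number of slots to be kept, for one player. -/
def reserveBody : Prog := Prog.list
  [.instr (.sub 12 12 23), .instr (.sub 13 13 24), .instr (.sub 14 14 5),
    .instr (.add 17 13 23), .instr (.store 17 9), .instr (.add 18 13 5), .instr (.load 18 18),
    .branch 18 (.branch 9 (.instr (.sub 9 9 5)) skip) (Prog.list
      [.instr (.sub 19 12 5), .instr (.load 19 19),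
        .branch 19 (Prog.list
          [.instr (.load 20 13), .instr (.sub 20 20 8), .instr (.mul 20 20 20),
            .branch 20 skip (.instr (.add 9 9 5))]) skip])]

/-- Decide whether one player enters. -/
def enterBody : Prog := Prog.list
  [.instr (.add 17 13 5), .instr (.load 18 17),
    .branch 18 (.instr (.add 9 9 5)) (Prog.list
      [.instr (.sub 19 12 5), .instr (.load 19 19),
        .branch 19 (Prog.list
          [.instr (.load 20 13), .instr (.sub 20 20 8), .instr (.mul 20 20 20),
            .branch 20 (.instr (.const 20 0)) (.instr (.add 20 9 6))])
          (Prog.list [.instr (.add 20 13 23), .instr (.load 20 20), .instr (.sub 20 9 20)]),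
        .branch 20 (Prog.list
          [.instr (.sub 9 9 5), .instr (.add 10 10 5), .instr (.load 21 12),
            .instr (.mul 21 21 8), .instr (.add 11 11 21), .instr (.add 22 8 5),
            .instr (.store 17 22)]) skip]),
    .instr (.add 12 12 23), .instr (.add 13 13 24), .instr (.sub 14 14 5)]

/-- Prepare the next guess at one player. -/
def nextBody : Prog := Prog.list
  [.instr (.add 17 13 5), .instr (.store 17 6),
    .branch 7 (Prog.list
      [.instr (.sub 18 12 5), .instr (.load 18 18),
        .branch 18 (Prog.list
          [.instr (.load 19 13), .instr (.sub 20 3 19),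
            .branch 20 (Prog.list
              [.instr (.add 19 19 5), .instr (.store 13 19), .instr (.const 7 0)])
              (.instr (.store 13 6))]) skip]) skip,
    .instr (.add 12 12 23), .instr (.add 13 13 24), .instr (.sub 14 14 5)]

/-- Set the pointers to the first player. -/
def toFirst : Prog := Prog.list
  [.instr (.const 12 3), .instr (.add 13 4 6), .instr (.add 14 1 6)]

/-- Set the pointers behind the last player. -/
def toLast : Prog := Prog.list
  [.instr (.const 9 0), .instr (.add 14 1 6), .instr (.add 12 4 5), .instr (.mul 13 1 24),
    .instr (.add 13 13 4)]

/-- Compute the number of slots to be kept, for all players. -/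
def reservePass : Prog := .seq toLast (.loop 14 reserveBody)

/-- Decide for all players whether they enter on the current level. -/
def enterPass : Prog :=
  .seq (.seq (Prog.list [.instr (.add 9 16 6), .instr (.const 16 0)]) toFirst)
    (.loop 14 enterBody)

/-- Fill up one level. -/
def levelBody : Prog :=
  .seq reservePass (.seq enterPass (Prog.list [.instr (.sub 8 8 5), .instr (.sub 15 15 5)]))

/-- Set the answer to one if all players have entered and the target is reached. -/
def acceptTest : Prog := Prog.list
  [.instr (.sub 17 1 10),
    .branch 17 skip (Prog.list [.instr (.sub 17 2 11), .branch 17 skip (.instr (.const 0 1))])]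

/-- Prepare the next guess. -/
def nextPass : Prog := .seq (.seq (.instr (.const 7 1)) toFirst) (.loop 14 nextBody)

/-- Set all registers for the first level. -/
def levelInit : Prog := Prog.list
  [.instr (.const 10 0), .instr (.const 11 0), .instr (.add 8 3 6), .instr (.add 15 3 5),
    .instr (.const 16 1)]

/-- Test one guess. -/
def guessBody : Prog :=
  .seq levelInit (.seq (.loop 15 levelBody) (.seq acceptTest
    (.seq nextPass (.instr (.sub 7 5 7)))))

/-- Process one player in the search for bad players. -/
def stackBody : Prog := Prog.list
  [.instr (.sub 17 12 5), .instr (.store 17 6), .instr (.load 18 12),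
    .branch 9 (Prog.list
      [.instr (.sub 19 13 24), .instr (.load 20 19), .instr (.load 21 20), .instr (.sub 22 18 21),
        .branch 22 (Prog.list
          [.instr (.sub 20 20 5), .instr (.store 20 5), .instr (.store 17 5),
            .instr (.sub 13 13 24), .instr (.sub 9 9 5)])
          (Prog.list [.instr (.store 13 12), .instr (.add 13 13 24), .instr (.add 9 9 5)])])
      (Prog.list [.instr (.store 13 12), .instr (.add 13 13 24), .instr (.add 9 9 5)]),
    .instr (.add 12 12 23), .instr (.sub 14 14 5)]

/-- Compute the number of rounds. -/
def roundsBody : Prog := Prog.list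
  [.instr (.add 17 17 17), .instr (.add 3 3 5), .instr (.sub 14 1 17)]

def setup : Prog := Prog.list
  [.instr (.const 5 1), .instr (.load 1 6), .instr (.load 2 5), .instr (.const 23 2),
    .instr (.const 24 3), .instr (.add 4 1 1), .instr (.add 4 4 23), .instr (.const 17 1),
    .instr (.sub 14 1 17)]

/-- Find a set of bad players. -/
def stackPass : Prog :=
  .seq (Prog.list [.instr (.add 13 4 23), .instr (.const 12 3), .instr (.add 14 1 6)])
    (.loop 14 stackBody)

/-- The program that solves Tournament Value Maximization. -/
def program : Prog :=
  .seq setup (.seq (.loop 14 roundsBody) (.seq stackPass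
    (.seq (.instr (.const 7 1)) (.loop 7 guessBody))))

/-! ### Predicates on machine states, memory layout and word size. -/

/-- The registers that hold constants. -/
structure Consts (n L : ℕ) (V : ℤ) (s : State) : Prop where
  r1 : s.reg 1 = n
  r2 : s.reg 2 = V
  r3 : s.reg 3 = L
  r4 : s.reg 4 = (2 * n + 2 : ℕ)
  r5 : s.reg 5 = 1
  r6 : s.reg 6 = 0
  r23 : s.reg 23 = 2
  r24 : s.reg 24 = 3

theorem Consts.set {n L : ℕ} {V : ℤ} {s : State} (h : Consts n L V s) {d : ℕ} {x : ℤ}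
    (hd : d = 0 ∨ 7 ≤ d ∧ d ≤ 22) : Consts n L V (s.set d x) := by
  constructor <;> rw [State.set_reg, if_neg (by omega)]
  exacts [h.r1, h.r2, h.r3, h.r4, h.r5, h.r6, h.r23, h.r24]

theorem Consts.put {n L : ℕ} {V : ℤ} {s : State} (h : Consts n L V s) {a : ℕ} {x : ℤ} :
    Consts n L V (s.put a x) := ⟨h.r1, h.r2, h.r3, h.r4, h.r5, h.r6, h.r23, h.r24⟩

theorem Consts.skip {n L : ℕ} {V : ℤ} {s : State} (h : Consts n L V s) {x : ℤ} (hx : x = 0) :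
    Consts n L V (s.set 6 x) := by
  constructor <;> rw [State.set_reg]
  case r6 => rw [if_pos rfl, hx]
  all_goals rw [if_neg (by omega)]
  exacts [h.r1, h.r2, h.r3, h.r4, h.r5, h.r23, h.r24]

/-- The contents of the memory, except for the slots to be kept. -/
structure Arrays (n : ℕ) (v : ℕ → ℤ) (bad : Finset ℕ) (g w : ℕ → ℕ) (m : ℕ → ℤ) : Prop where
  bad : ∀ i < n, m (2 * i + 2) = if i ∈ bad then 1 else 0
  val : ∀ i < n, m (2 * i + 3) = v i
  guess : ∀ i < n, m (2 * n + 2 + 3 * i) = g i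
  lab : ∀ i < n, m (2 * n + 3 + 3 * i) = w i

/-- Above the input, guesses, labels and slots occupy different residue classes modulo `3`, so
writing to one array leaves the others alone. -/
theorem Arrays.put_slot {n : ℕ} {v : ℕ → ℤ} {bad : Finset ℕ} {g w : ℕ → ℕ} {m : ℕ → ℤ}
    (h : Arrays n v bad g w m) (i : ℕ) (x : ℤ) :
    Arrays n v bad g w (Function.update m (2 * n + 4 + 3 * i) x) := by
  constructor <;> intro j hj <;> rw [Function.update_of_ne (by omega)]
  exacts [h.bad j hj, h.val j hj, h.guess j hj, h.lab j hj]

theorem Arrays.put_lab {n : ℕ} {v : ℕ → ℤ} {bad : Finset ℕ} {g w : ℕ → ℕ} {m : ℕ → ℤ}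
    (h : Arrays n v bad g w m) (i x : ℕ) :
    Arrays n v bad g (Function.update w i x) (Function.update m (2 * n + 3 + 3 * i) x) := by
  refine ⟨fun j hj => ?_, fun j hj => ?_, fun j hj => ?_, fun j hj => ?_⟩
  · rw [Function.update_of_ne (by omega), h.bad j hj]
  · rw [Function.update_of_ne (by omega), h.val j hj]
  · rw [Function.update_of_ne (by omega), h.guess j hj]
  · rcases eq_or_ne j i with rfl | hne
    · simp
    · rw [Function.update_of_ne (by omega), Function.update_of_ne hne, h.lab j hj]

theorem Arrays.put_guess {n : ℕ} {v : ℕ → ℤ} {bad : Finset ℕ} {g w : ℕ → ℕ} {m : ℕ → ℤ}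
    (h : Arrays n v bad g w m) (i x : ℕ) :
    Arrays n v bad (Function.update g i x) w (Function.update m (2 * n + 2 + 3 * i) x) := by
  refine ⟨fun j hj => ?_, fun j hj => ?_, fun j hj => ?_, fun j hj => ?_⟩
  · rw [Function.update_of_ne (by omega), h.bad j hj]
  · rw [Function.update_of_ne (by omega), h.val j hj]
  · rcases eq_or_ne j i with rfl | hne
    · simp
    · rw [Function.update_of_ne (by omega), Function.update_of_ne hne, h.guess j hj]
  · rw [Function.update_of_ne (by omega), h.lab j hj]

theorem Arrays.congr {n : ℕ} {v : ℕ → ℤ} {bad : Finset ℕ} {g w g' w' : ℕ → ℕ} {m : ℕ → ℤ}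
    (h : Arrays n v bad g w m) (hg : ∀ i < n, g i = g' i) (hw : ∀ i < n, w i = w' i) :
    Arrays n v bad g' w' m :=
  ⟨h.bad, h.val, fun i hi => hg i hi ▸ h.guess i hi, fun i hi => hw i hi ▸ h.lab i hi⟩

/-- The registers in `l` are the same in both states. -/
def Frame (l : List ℕ) (s₀ s : State) : Prop := ∀ r ∈ l, s.reg r = s₀.reg r

theorem Frame.set {l : List ℕ} {s₀ s : State} (h : Frame l s₀ s) {d : ℕ} {x : ℤ} (hd : d ∉ l) :
    Frame l s₀ (s.set d x) := fun r hr => by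
  rw [State.set_reg, if_neg (fun e : r = d => hd (e ▸ hr)), h r hr]

theorem Frame.put {l : List ℕ} {s₀ s : State} (h : Frame l s₀ s) {a : ℕ} {x : ℤ} :
    Frame l s₀ (s.put a x) := h

theorem Frame.refl (l : List ℕ) (s : State) : Frame l s s := fun _ _ => rfl

theorem Frame.trans {l : List ℕ} {s₀ s₁ s₂ : State} (h : Frame l s₀ s₁) (h' : Frame l s₁ s₂) :
    Frame l s₀ s₂ := fun r hr => (h' r hr).trans (h r hr)

theorem Frame.subset {l l' : List ℕ} {s₀ s : State} (h : Frame l s₀ s) (hl : l' ⊆ l) :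
    Frame l' s₀ s := fun r hr => h r (hl hr)

/-- Words are large enough for the instance. -/
structure Fits (B n L : ℕ) (V : ℤ) (v : ℕ → ℤ) : Prop where
  addr : 8 * n + 8 ≤ B
  sq : (L + 1) * (L + 1) ≤ B
  target : V.natAbs ≤ B
  val : ∀ i < n, 2 * (v i).natAbs ≤ B
  wins : ∀ i < n, (v i).natAbs * L ≤ B
  sum : ∀ w : ℕ → ℕ, (∀ i, w i ≤ L + 1) → V.natAbs + (labelSum n v w).natAbs ≤ B

end Tournament

namespace Tournament

open RAM RAM.Instr RAM.Prog

/-! ### Partially updated arrays and bounds on register contents. -/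

section Loops

variable {B n L : ℕ} {V : ℤ} {v : ℕ → ℤ} {bad : Finset ℕ} {g w : ℕ → ℕ}

/-- The first `t` values of `f`, followed by the values of `h`. -/
def splice (t : ℕ) (f h : ℕ → ℕ) (i : ℕ) : ℕ := if i < t then f i else h i

theorem splice_of_lt {t i : ℕ} {f h : ℕ → ℕ} (hi : i < t) : splice t f h i = f i := if_pos hi

theorem splice_self (t : ℕ) (f h : ℕ → ℕ) : splice t f h t = h t := if_neg (lt_irrefl t)

theorem splice_succ (t : ℕ) (f h : ℕ → ℕ) :
    splice (t + 1) f h = Function.update (splice t f h) t (f t) := by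
  funext i
  rcases eq_or_ne i t with rfl | hi
  · simp [splice]
  · rw [Function.update_of_ne hi]
    unfold splice
    congr 1
    rw [eq_iff_iff]
    omega

theorem splice_succ_of_eq {t : ℕ} {f h : ℕ → ℕ} (e : f t = h t) :
    splice (t + 1) f h = splice t f h := by
  rw [splice_succ, e, ← splice_self t f h, Function.update_eq_self]

theorem reserve_le (d t : ℕ) : reserve n bad g d w t ≤ n - t := by
  have : ∀ j, reserveAux n bad g d w j ≤ j := by
    intro j
    induction j with
    | zero => rfl
    | succ j ih => rw [reserveAux]; split_ifs <;> omega
  exact this _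

theorem openSlots_le (d e t : ℕ) : openSlots n bad g d e w t ≤ e + t := by
  induction t with
  | zero => exact le_rfl
  | succ t ih => rw [openSlots]; split_ifs <;> omega

theorem labelCount_le (n : ℕ) (w : ℕ → ℕ) : labelCount n w ≤ n :=
  (Finset.card_filter_le _ _).trans (Finset.card_range n).le

theorem labelCount_update {t x : ℕ} (ht : t < n) (h : w t = 0) (hx : 0 < x) :
    labelCount n (Function.update w t x) = labelCount n w + 1 := by
  unfold labelCount
  rw [← Finset.card_insert_of_notMem (a := t) (s := (Finset.range n).filter fun t => 0 < w t)
    (by simp [h])]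
  congr 1
  ext i
  simp only [Finset.mem_filter, Finset.mem_range, Finset.mem_insert]
  rcases eq_or_ne i t with rfl | hi
  · simp [ht, hx]
  · simp [hi]

theorem labelSum_update {t : ℕ} (ht : t < n) (h : w t = 0) (d : ℕ) :
    labelSum n v (Function.update w t (d + 1)) = labelSum n v w + v t * d := by
  unfold labelSum
  have ht' := Finset.mem_range.2 ht
  rw [← Finset.add_sum_erase _ _ ht', ← Finset.add_sum_erase (Finset.range n)
    (fun s => v s * ((w s - 1 : ℕ) : ℤ)) ht']
  rw [Finset.sum_congr rfl fun i hi => by rw [Function.update_of_ne (Finset.ne_of_mem_erase hi)]]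
  simp [h]
  ring

theorem labelCount_congr {w' : ℕ → ℕ} (h : ∀ i < n, w i = w' i) :
    labelCount n w = labelCount n w' := by
  unfold labelCount
  congr 1
  exact Finset.filter_congr fun i hi => by rw [h i (Finset.mem_range.1 hi)]

theorem labelSum_congr {w' : ℕ → ℕ} (h : ∀ i < n, w i = w' i) :
    labelSum n v w = labelSum n v w' :=
  Finset.sum_congr rfl fun i hi => by rw [h i (Finset.mem_range.1 hi)]

theorem natAbs_sub_mul_self_le {a b c : ℕ} (ha : a ≤ c) (hb : b ≤ c) :
    (((a : ℤ) - b) * ((a : ℤ) - b)).natAbs ≤ (c + 1) * (c + 1) := by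
  rw [Int.natAbs_mul]
  exact Nat.mul_le_mul (by omega) (by omega)

/-- The machine only tests for positivity; squaring a difference turns equality into such a test. -/
theorem sub_mul_self_nonpos_iff {a b : ℕ} : ((a : ℤ) - b) * ((a : ℤ) - b) ≤ 0 ↔ a = b := by
  constructor
  · intro h
    have := mul_self_eq_zero.1 (le_antisymm h (mul_self_nonneg _))
    omega
  · rintro rfl
    simp

/-! ### The pass that computes the slots to be kept -/

/-- The state before player `t - 1` is processed in the backward pass over level `d`. -/
structure ReserveInv (n L : ℕ) (V : ℤ) (v : ℕ → ℤ) (bad : Finset ℕ) (g w : ℕ → ℕ) (d : ℕ)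
    (s₀ : State) (t : ℕ) (s : State) : Prop where
  consts : Consts n L V s
  arrays : Arrays n v bad g w s.mem
  frame : Frame [0, 7, 8, 10, 11, 15, 16] s₀ s
  slots : ∀ i < n, t ≤ i → s.mem (2 * n + 4 + 3 * i) = reserve n bad g d w (i + 1)
  r9 : s.reg 9 = reserve n bad g d w t
  r12 : s.reg 12 = (2 * t + 3 : ℕ)
  r13 : s.reg 13 = (2 * n + 2 + 3 * t : ℕ)
  r14 : s.reg 14 = t

/-- Symbolic execution, with all branches ending in `leaf` and matched to the cases of `reserve_eq`.
The slot cell is written before register `9` changes, hence it holds the reserve after player `t`,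
which is what `Enters` consults. -/
theorem reserveBody_wp (hF : Fits B n L V v) {d t : ℕ} (hd : d ≤ L) (hg : ∀ i < n, g i ≤ L)
    (hw : ∀ i, w i ≤ L + 1) (ht : t < n) {s₀ s : State} (h8 : s₀.reg 8 = d)
    (h : ReserveInv n L V v bad g w d s₀ (t + 1) s) :
    reserveBody.wp B (ReserveInv n L V v bad g w d s₀ t) s := by
  obtain ⟨hc, ha, hf, hs, h9, h12, h13, h14⟩ := h
  have h8' : s.reg 8 = d := (hf 8 (by simp)).trans h8
  have leaf : ∀ s', Consts n L V s' → Frame [0, 7, 8, 10, 11, 15, 16] s₀ s' →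
      s'.mem = Function.update s.mem (2 * n + 4 + 3 * t) (reserve n bad g d w (t + 1)) →
      s'.reg 12 = (2 * t + 3 : ℕ) → s'.reg 13 = (2 * n + 2 + 3 * t : ℕ) → s'.reg 14 = t →
      s'.reg 9 = reserve n bad g d w t → ReserveInv n L V v bad g w d s₀ t s' := by
    intro s' h1 h2 h3 h4 h5 h6 h7
    refine ⟨h1, h3 ▸ ha.put_slot t _, h2, fun i hi hti => ?_, h7, h4, h5, h6⟩
    rw [h3]
    rcases Nat.eq_or_lt_of_le hti with rfl | hlt
    · simp
    · rw [Function.update_of_ne (by omega), hs i hi hlt]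
  have e1 : ((2 * (t + 1) + 3 : ℕ) : ℤ) - 2 = (2 * t + 3 : ℕ) := by omega
  have e2 : ((2 * n + 2 + 3 * (t + 1) : ℕ) : ℤ) - 3 = (2 * n + 2 + 3 * t : ℕ) := by omega
  have e3 : ((2 * n + 2 + 3 * t : ℕ) : ℤ) + 2 = (2 * n + 4 + 3 * t : ℕ) := by omega
  have e4 : ((2 * n + 2 + 3 * t : ℕ) : ℤ) + 1 = (2 * n + 3 + 3 * t : ℕ) := by omega
  have e5 : ((2 * t + 3 : ℕ) : ℤ) - 1 = (2 * t + 2 : ℕ) := by omega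
  have e6 : ((t + 1 : ℕ) : ℤ) - 1 = t := by omega
  have a1 : 2 * n + 3 + 3 * t ≠ 2 * n + 4 + 3 * t := by omega
  have a2 : 2 * t + 2 ≠ 2 * n + 4 + 3 * t := by omega
  have a3 : 2 * n + 2 + 3 * t ≠ 2 * n + 4 + 3 * t := by omega
  have b1 := hF.addr
  have b2 : L + 1 ≤ B := (Nat.le_mul_self _).trans hF.sq
  have b3 := (natAbs_sub_mul_self_le (hg t ht) hd).trans hF.sq
  have b4 := hw t
  have b5 := reserve_le (n := n) (bad := bad) (g := g) (w := w) d (t + 1)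
  have b6 := hg t ht
  have z := sub_mul_self_nonpos_iff (a := g t) (b := d)
  have hr := reserve_eq n bad g d w ht
  by_cases hb : t ∈ bad
  all_goals
    simp only [hb, true_and, false_and, reduceIte] at hr
    simp only [reserveBody, skip, Prog.list, Prog.wp, Instr.wp, State.set_reg, State.set_mem,
      State.put_reg, State.put_mem, Nat.reduceEqDiff, reduceIte, hc.r5, hc.r23, hc.r24, h8', h12,
      h13, h9, h14, e1, e2, e3, e4, e5, e6, Int.toNat_natCast, if_neg a1, if_neg a2, if_neg a3,
      ha.lab t ht, ha.bad t ht, ha.guess t ht, hb]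
    repeat' first | apply And.intro | intro _
    all_goals first
      | assumption
      | refine leaf _ ?_ ?_ rfl rfl rfl rfl ?_
        · repeat first
            | exact hc | apply Consts.put | refine Consts.set ?_ (by omega)
            | refine Consts.skip ?_ rfl
        · repeat first | exact hf | apply Frame.put | refine Frame.set ?_ (by decide)
        · simp only [State.set_reg, State.put_reg, Nat.reduceEqDiff, reduceIte, h9]
          split_ifs at hr <;> omega
      | (clear b3; omega)

theorem runs_reservePass (hF : Fits B n L V v) {d : ℕ} (hd : d ≤ L) (hg : ∀ i < n, g i ≤ L)
    (hw : ∀ i, w i ≤ L + 1) {s : State} (h8 : s.reg 8 = d) (hc : Consts n L V s)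
    (ha : Arrays n v bad g w s.mem) :
    Runs B reservePass (5 + (n * (reserveBody.cost + 1) + 1))
      (ReserveInv n L V v bad g w d s 0) s := by
  refine Prog.runs_seq_of_wp (p := toLast) ?_
  have hI : ∀ s', ReserveInv n L V v bad g w d s n s' →
      Runs B (.loop 14 reserveBody) (n * (reserveBody.cost + 1) + 1)
        (ReserveInv n L V v bad g w d s 0) s' := by
    intro s' hs'
    have := Runs.loop (B := B) (a := 14) (p := reserveBody) (T := reserveBody.cost) (N := n)
      (Inv := fun j => ReserveInv n L V v bad g w d s (n - j)) (s := s')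
      (fun j hj s₁ h => ⟨?_, Prog.runs_of_wp ?_⟩) (fun s₁ h => ?_) hs'
    · simpa using this
    · rw [h.r14]; omega
    · rw [show n - j = n - (j + 1) + 1 by omega] at h
      exact reserveBody_wp hF hd hg hw (by omega) h8 h
    · rw [h.r14]; omega
  have b1 := hF.addr
  have e1 : ((2 * n + 2 : ℕ) : ℤ) + 1 = (2 * n + 3 : ℕ) := by omega
  have e2 : (n : ℤ) * 3 + (2 * n + 2 : ℕ) = (2 * n + 2 + 3 * n : ℕ) := by push_cast; ring
  simp only [toLast, Prog.list, Prog.wp, Instr.wp, State.set_reg,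
      Nat.reduceEqDiff, reduceIte, hc.r1, hc.r4, hc.r5, hc.r6, hc.r24, e1, e2, add_zero]
  refine ⟨by omega, by omega, by omega, by omega, by omega, hI _ ⟨?_, ha, ?_, ?_, ?_, rfl, rfl, rfl⟩⟩
  · repeat first | exact hc | refine Consts.set ?_ (by omega)
  · repeat first | exact Frame.refl _ _ | refine Frame.set ?_ (by decide)
  · intro i hi hni; omega
  · rw [reserve_self]; rfl

end Loops

end Tournament

namespace Tournament

open RAM RAM.Instr RAM.Prog

section Loops

variable {B n L : ℕ} {V : ℤ} {v : ℕ → ℤ} {bad : Finset ℕ} {g w : ℕ → ℕ}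

/-! ### The pass that decides who enters -/

/-- The state before player `t` is processed in the forward pass over level `d`, where the labels
change from `w` to `w'`. -/
structure EnterInv (n L : ℕ) (V : ℤ) (v : ℕ → ℤ) (bad : Finset ℕ) (g w w' : ℕ → ℕ) (d e : ℕ)
    (s₀ : State) (t : ℕ) (s : State) : Prop where
  consts : Consts n L V s
  arrays : Arrays n v bad g (splice t w' w) s.mem
  frame : Frame [0, 7, 8, 15] s₀ s
  slots : ∀ i < n, s.mem (2 * n + 4 + 3 * i) = reserve n bad g d w (i + 1)
  r9 : s.reg 9 = openSlots n bad g d e w t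
  r10 : s.reg 10 = labelCount n (splice t w' w)
  r11 : s.reg 11 = labelSum n v (splice t w' w)
  r12 : s.reg 12 = (2 * t + 3 : ℕ)
  r13 : s.reg 13 = (2 * n + 2 + 3 * t : ℕ)
  r14 : s.reg 14 = (n - t : ℕ)
  r16 : s.reg 16 = 0

-- Each branch ends in one of two ways: `stay` leaves memory unchanged, and `enter` writes the label
-- and updates the count and the sum.
set_option maxHeartbeats 1600000 in
theorem enterBody_wp (hF : Fits B n L V v) {d e t : ℕ} (hd : d ≤ L) (he : e ≤ 1)
    (hg : ∀ i < n, g i ≤ L) (hw : ∀ i, w i ≤ L + 1) (ht : t < n) {s₀ s : State}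
    (h8 : s₀.reg 8 = d)
    (h : EnterInv n L V v bad g w (fillLevel n bad g d e w) d e s₀ t s) :
    enterBody.wp B (EnterInv n L V v bad g w (fillLevel n bad g d e w) d e s₀ (t + 1)) s := by
  have hw' : ∀ i, fillLevel n bad g d e w i ≤ L + 1 := by
    intro i; unfold fillLevel; have := hw i; split_ifs <;> omega
  have hwt : ∀ t i, splice t (fillLevel n bad g d e w) w i ≤ L + 1 := by
    intro t i; unfold splice; have := hw i; have := hw' i; split_ifs <;> omega
  obtain ⟨hc, ha, hf, hs, h9, h10, h11, h12, h13, h14, h16⟩ := h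
  have h8' : s.reg 8 = d := (hf 8 (by simp)).trans h8
  set f := fillLevel n bad g d e w with hfdef
  have e1 : ((2 * t + 3 : ℕ) : ℤ) + 2 = (2 * (t + 1) + 3 : ℕ) := by omega
  have e2 : ((2 * n + 2 + 3 * t : ℕ) : ℤ) + 3 = (2 * n + 2 + 3 * (t + 1) : ℕ) := by omega
  have e3 : ((2 * n + 2 + 3 * t : ℕ) : ℤ) + 2 = (2 * n + 4 + 3 * t : ℕ) := by omega
  have e4 : ((2 * n + 2 + 3 * t : ℕ) : ℤ) + 1 = (2 * n + 3 + 3 * t : ℕ) := by omega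
  have e5 : ((2 * t + 3 : ℕ) : ℤ) - 1 = (2 * t + 2 : ℕ) := by omega
  have e6 : ((n - t : ℕ) : ℤ) - 1 = (n - (t + 1) : ℕ) := by omega
  have e7 : (d : ℤ) + 1 = (d + 1 : ℕ) := by omega
  have hlab : s.mem (2 * n + 3 + 3 * t) = w t := by
    rw [ha.lab t ht, splice_self]
  have stay : ∀ s', ¬ Enters n bad g d w (openSlots n bad g d e w t) t →
      Consts n L V s' → Frame [0, 7, 8, 15] s₀ s' → s'.mem = s.mem →
      s'.reg 9 = openSlots n bad g d e w (t + 1) → s'.reg 10 = s.reg 10 → s'.reg 11 = s.reg 11 →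
      s'.reg 12 = (2 * (t + 1) + 3 : ℕ) → s'.reg 13 = (2 * n + 2 + 3 * (t + 1) : ℕ) →
      s'.reg 14 = (n - (t + 1) : ℕ) → s'.reg 16 = s.reg 16 →
      EnterInv n L V v bad g w f d e s₀ (t + 1) s' := by
    intro s' h0 h1 h2 h3 h4 h5 h6 h7 h8 h9 h16'
    have hfw : f t = w t := by
      rw [hfdef, fillLevel, if_neg h0]
    have hsp := splice_succ_of_eq hfw
    exact ⟨h1, by rw [hsp, h3]; exact ha, h2, by rw [h3]; exact hs, h4, by rw [hsp, h5, h10],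
      by rw [hsp, h6, h11], h7, h8, h9, h16'.trans h16⟩
  have enter : ∀ s', Enters n bad g d w (openSlots n bad g d e w t) t →
      Consts n L V s' → Frame [0, 7, 8, 15] s₀ s' →
      s'.mem = Function.update s.mem (2 * n + 3 + 3 * t) (d + 1 : ℕ) →
      s'.reg 9 = openSlots n bad g d e w (t + 1) → s'.reg 10 = s.reg 10 + 1 →
      s'.reg 11 = s.reg 11 + v t * d →
      s'.reg 12 = (2 * (t + 1) + 3 : ℕ) → s'.reg 13 = (2 * n + 2 + 3 * (t + 1) : ℕ) →
      s'.reg 14 = (n - (t + 1) : ℕ) → s'.reg 16 = s.reg 16 →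
      EnterInv n L V v bad g w f d e s₀ (t + 1) s' := by
    intro s' h0 h1 h2 h3 h4 h5 h6 h7 h8 h9 h16'
    have hfw : f t = d + 1 := by rw [hfdef, fillLevel, if_pos h0]
    have hz : splice t f w t = 0 := by rw [splice_self, h0.1]
    refine ⟨h1, by rw [splice_succ, h3, hfw]; exact ha.put_lab t _, h2, fun i hi => ?_, h4, ?_, ?_,
      h7, h8, h9, h16'.trans h16⟩
    · rw [h3, Function.update_of_ne (by omega), hs i hi]
    · rw [splice_succ, hfw, labelCount_update ht hz (by omega), h5, h10]; push_cast; rfl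
    · rw [splice_succ, hfw, labelSum_update ht hz, h6, h11]
  have b1 := hF.addr
  have b2 : L + 1 ≤ B := (Nat.le_mul_self _).trans hF.sq
  have b3 := (natAbs_sub_mul_self_le (hg t ht) hd).trans hF.sq
  have b4 := hw t
  have b5 := openSlots_le (n := n) (bad := bad) (g := g) (w := w) d e t
  have b6 := hg t ht
  have b8 := reserve_le (n := n) (bad := bad) (g := g) (w := w) d (t + 1)
  have b9 := labelCount_le n (splice t f w)
  have b10 : (v t).natAbs ≤ B := by have := hF.val t ht; omega
  have b11 : (v t * d).natAbs ≤ B := by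
    rw [Int.natAbs_mul, Int.natAbs_natCast]
    exact (Nat.mul_le_mul_left _ hd).trans (hF.wins t ht)
  -- No overflow in the running sum: it is the label sum of the next spliced labelling, and
  -- `Fits.sum` covers every labelling.
  have b13 : Enters n bad g d w (openSlots n bad g d e w t) t →
      (labelSum n v (splice t f w) + v t * d).natAbs ≤ B := by
    intro h0
    have hz : splice t f w t = 0 := by rw [splice_self, h0.1]
    have := hF.sum (splice (t + 1) f w) (hwt _)
    rw [splice_succ, hfdef, fillLevel, if_pos h0, labelSum_update ht hz] at this
    omega
  have z := sub_mul_self_nonpos_iff (a := g t) (b := d)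
  have ho : openSlots n bad g d e w (t + 1) = _ := openSlots.eq_2 ..
  by_cases hb : t ∈ bad
  all_goals
    have hE : Enters n bad g d w (openSlots n bad g d e w t) t ↔ w t = 0 ∧ _ := Iff.rfl
    simp only [hb, reduceIte] at hE
    have hEpos := fun h : Enters n bad g d w (openSlots n bad g d e w t) t => h.pos
    simp only [hE] at ho stay enter b13 hEpos
    simp only [enterBody, skip, Prog.list, Prog.wp, Instr.wp, State.set_reg, State.set_mem,
      State.put_reg, Nat.reduceEqDiff, reduceIte, hc.r5, hc.r6, hc.r23, hc.r24, h8', h12,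
      h13, h9, h14, h10, h11, e1, e2, e3, e4, e5, e6, e7, Int.toNat_natCast, add_zero,
      hlab, ha.bad t ht, ha.guess t ht, ha.val t ht, hs t ht, hb]
    repeat' first | apply And.intro | intro _
    all_goals first
      | assumption
      | refine stay _ ?_ ?_ ?_ rfl ?_ rfl rfl rfl rfl rfl rfl
        · clear b3 b10 b11; omega
        · repeat first
            | exact hc | apply Consts.put | refine Consts.set ?_ (by omega)
            | refine Consts.skip ?_ rfl
        · repeat first | exact hf | apply Frame.put | refine Frame.set ?_ (by decide)
        · simp only [State.set_reg, Nat.reduceEqDiff, reduceIte, h9]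
          clear b3 b10 b11
          split_ifs at ho <;> omega
      | refine enter _ ?_ ?_ ?_ rfl ?_ ?_ ?_ rfl rfl rfl rfl
        · clear b3 b10 b11; omega
        · repeat first
            | exact hc | apply Consts.put | refine Consts.set ?_ (by omega)
            | refine Consts.skip ?_ rfl
        · repeat first | exact hf | apply Frame.put | refine Frame.set ?_ (by decide)
        · simp only [State.set_reg, State.put_reg, Nat.reduceEqDiff, reduceIte, h9]
          clear b3 b10 b11
          split_ifs at ho <;> omega
        · rw [h10]; rfl
        · rw [h11]; rfl
      | exact b13 (by clear b3 b10 b11; omega)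
      | (clear b3 b10 b11; omega)

end Loops

end Tournament

namespace Tournament

open RAM RAM.Instr RAM.Prog

section Loops

variable {B n L : ℕ} {V : ℤ} {v : ℕ → ℤ} {bad : Finset ℕ} {g w : ℕ → ℕ}

theorem runs_enterPass (hF : Fits B n L V v) {d e : ℕ} (hd : d ≤ L) (he : e ≤ 1)
    (hg : ∀ i < n, g i ≤ L) (hw : ∀ i, w i ≤ L + 1) {s : State} (h8 : s.reg 8 = d)
    (hc : Consts n L V s) (ha : Arrays n v bad g w s.mem)
    (hs : ∀ i < n, s.mem (2 * n + 4 + 3 * i) = reserve n bad g d w (i + 1))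
    (h10 : s.reg 10 = labelCount n w) (h11 : s.reg 11 = labelSum n v w) (h16 : s.reg 16 = e) :
    Runs B enterPass (5 + (n * (enterBody.cost + 1) + 1))
      (EnterInv n L V v bad g w (fillLevel n bad g d e w) d e s n) s := by
  refine Prog.runs_seq_of_wp (p := .seq _ toFirst) ?_
  have hI : ∀ s', EnterInv n L V v bad g w (fillLevel n bad g d e w) d e s 0 s' →
      Runs B (.loop 14 enterBody) (n * (enterBody.cost + 1) + 1)
        (EnterInv n L V v bad g w (fillLevel n bad g d e w) d e s n) s' := by
    intro s' hs'
    refine Runs.loop (fun j hj s₁ h => ⟨?_, Prog.runs_of_wp ?_⟩) (fun s₁ h => ?_) hs'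
    · rw [h.r14]; omega
    · exact enterBody_wp hF hd he hg hw hj h8 h
    · rw [h.r14]; omega
  have b1 := hF.addr
  simp only [toFirst, Prog.list, Prog.wp, Instr.wp, State.set_reg,
      Nat.reduceEqDiff, reduceIte, hc.r1, hc.r4, hc.r6, h16, add_zero]
  refine ⟨by omega, by omega, by omega, by omega, by omega,
    hI _ ⟨?_, ha, ?_, hs, rfl, h10, h11, rfl, rfl, rfl, rfl⟩⟩
  · repeat first | exact hc | refine Consts.set ?_ (by omega)
  · repeat first | exact Frame.refl _ _ | refine Frame.set ?_ (by decide)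

/-! ### The loop over the levels -/

/-- The state after `j` levels have been filled. -/
structure LevelInv (n L : ℕ) (V : ℤ) (v : ℕ → ℤ) (bad : Finset ℕ) (g : ℕ → ℕ) (s₀ : State)
    (j : ℕ) (s : State) : Prop where
  consts : Consts n L V s
  arrays : Arrays n v bad g (labels n bad g L j) s.mem
  frame : Frame [0, 7] s₀ s
  r8 : s.reg 8 = L - j
  r10 : s.reg 10 = labelCount n (labels n bad g L j)
  r11 : s.reg 11 = labelSum n v (labels n bad g L j)
  r15 : s.reg 15 = L + 1 - j
  r16 : s.reg 16 = if j = 0 then 1 else 0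

theorem labels_le {j : ℕ} (hj : j ≤ L + 1) (t : ℕ) : labels n bad g L j t ≤ L + 1 := by
  have := labels_range (n := n) (bad := bad) (g := g) j hj t
  omega

/-- An upper bound for the number of steps per level. -/
def levelCost (n : ℕ) : ℕ :=
  (5 + (n * (reserveBody.cost + 1) + 1)) + ((5 + (n * (enterBody.cost + 1) + 1)) + 2)

/-- Register `16` supplies the champion's slot on level `L`; the forward pass clears it, so lower
levels start with no open slot. -/
theorem runs_levelBody (hF : Fits B n L V v) (hg : ∀ i < n, g i ≤ L) {j : ℕ} (hj : j < L + 1)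
    {s₀ s : State} (h : LevelInv n L V v bad g s₀ j s) :
    Runs B levelBody (levelCost n) (LevelInv n L V v bad g s₀ (j + 1)) s := by
  have h8 : s.reg 8 = (L - j : ℕ) := by rw [h.r8]; omega
  have hw := labels_le (n := n) (bad := bad) (g := g) (L := L) (j := j) (by omega)
  have he : (if j = 0 then 1 else 0) ≤ 1 := by split_ifs <;> omega
  refine Runs.seq (runs_reservePass hF (Nat.sub_le L j) hg hw h8 h.consts h.arrays) fun s₁ h₁ => ?_
  refine Runs.seq (runs_enterPass (e := if j = 0 then 1 else 0) hF (Nat.sub_le L j) he hg hw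
    ((h₁.frame 8 (by simp)).trans h8) h₁.consts h₁.arrays
    (fun i hi => h₁.slots i hi (Nat.zero_le i)) ((h₁.frame 10 (by simp)).trans h.r10)
    ((h₁.frame 11 (by simp)).trans h.r11) ?_) fun s₂ h₂ => ?_
  · rw [h₁.frame 16 (by simp), h.r16]; split_ifs <;> rfl
  · have f8 : s₂.reg 8 = L - j := (h₂.frame 8 (by simp)).trans ((h₁.frame 8 (by simp)).trans h.r8)
    have f15 : s₂.reg 15 = L + 1 - j :=
      (h₂.frame 15 (by simp)).trans ((h₁.frame 15 (by simp)).trans h.r15)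
    have hlab : ∀ i < n, splice n (fillLevel n bad g (L - j) (if j = 0 then 1 else 0)
        (labels n bad g L j)) (labels n bad g L j) i = labels n bad g L (j + 1) i := by
      intro i hi
      rw [splice_of_lt hi, labels]
    have hf : Frame [0, 7] s₀ s₂ :=
      (h.frame.trans (h₁.frame.subset (by simp))).trans (h₂.frame.subset (by simp))
    have b1 : L + 1 ≤ B := (Nat.le_mul_self _).trans hF.sq
    have hc := h₂.consts
    refine Prog.runs_of_wp (p := Prog.list [_, _]) ?_
    simp only [Prog.list, Prog.wp, Instr.wp, State.set_reg, Nat.reduceEqDiff, reduceIte, hc.r5,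
      f8, f15]
    refine ⟨by omega, by omega, ?_, h₂.arrays.congr (fun _ _ => rfl) hlab, ?_, ?_, ?_, ?_, ?_, ?_⟩
    · repeat first | exact hc | refine Consts.set ?_ (by omega)
    · repeat first | exact hf | refine Frame.set ?_ (by decide)
    · simp only [State.set_reg, Nat.reduceEqDiff, reduceIte]; omega
    · rw [← labelCount_congr hlab, ← h₂.r10]; rfl
    · rw [← labelSum_congr hlab, ← h₂.r11]; rfl
    · simp only [State.set_reg, Nat.reduceEqDiff, reduceIte]; omega
    · rw [if_neg (by omega), ← h₂.r16]; rfl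

/-! ### The preparation of the next guess -/

/-- The state before player `t` is processed in the change from guess `j` to guess `j + 1`. -/
structure NextInv (n L : ℕ) (V : ℤ) (v : ℕ → ℤ) (bad : Finset ℕ) (w : ℕ → ℕ) (j : ℕ)
    (s₀ : State) (t : ℕ) (s : State) : Prop where
  consts : Consts n L V s
  arrays : Arrays n v bad (splice t (digit (L + 1) bad (j + 1)) (digit (L + 1) bad j))
    (splice t (fun _ => 0) w) s.mem
  frame : Frame [0] s₀ s
  r7 : s.reg 7 = quotient (L + 1) bad (j + 1) t - quotient (L + 1) bad j t
  r12 : s.reg 12 = (2 * t + 3 : ℕ)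
  r13 : s.reg 13 = (2 * n + 2 + 3 * t : ℕ)
  r14 : s.reg 14 = (n - t : ℕ)

theorem digit_lt (K : ℕ) (hK : 0 < K) (j i : ℕ) : digit K bad j i < K := by
  unfold digit
  split_ifs
  exacts [Nat.mod_lt _ hK, hK]

/-- One digit of incrementing the counter, with the carry in register `7`; the label is reset on the
way. -/
theorem nextBody_wp (hF : Fits B n L V v) {j t : ℕ} (ht : t < n) {s₀ s : State}
    (h : NextInv n L V v bad w j s₀ t s) :
    nextBody.wp B (NextInv n L V v bad w j s₀ (t + 1)) s := by
  obtain ⟨hc, ha, hf, h7, h12, h13, h14⟩ := h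
  have e1 : ((2 * t + 3 : ℕ) : ℤ) + 2 = (2 * (t + 1) + 3 : ℕ) := by omega
  have e2 : ((2 * n + 2 + 3 * t : ℕ) : ℤ) + 3 = (2 * n + 2 + 3 * (t + 1) : ℕ) := by omega
  have e4 : ((2 * n + 2 + 3 * t : ℕ) : ℤ) + 1 = (2 * n + 3 + 3 * t : ℕ) := by omega
  have e5 : ((2 * t + 3 : ℕ) : ℤ) - 1 = (2 * t + 2 : ℕ) := by omega
  have e6 : ((n - t : ℕ) : ℤ) - 1 = (n - (t + 1) : ℕ) := by omega
  have a1 : 2 * n + 2 + 3 * t ≠ 2 * n + 3 + 3 * t := by omega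
  have a2 : 2 * t + 2 ≠ 2 * n + 3 + 3 * t := by omega
  have hgt : s.mem (2 * n + 2 + 3 * t) = digit (L + 1) bad j t := by
    rw [ha.guess t ht, splice_self]
  set D := digit (L + 1) bad j with hD
  set D' := digit (L + 1) bad (j + 1) with hD'
  set q := quotient (L + 1) bad j with hq
  set q' := quotient (L + 1) bad (j + 1) with hq'
  have ha' : Arrays n v bad (splice t D' D) (splice (t + 1) (fun _ => 0) w)
      (Function.update s.mem (2 * n + 3 + 3 * t) 0) := by
    rw [splice_succ]; exact ha.put_lab t 0
  have stay : ∀ s', D' t = D t → Consts n L V s' → Frame [0] s₀ s' →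
      s'.mem = Function.update s.mem (2 * n + 3 + 3 * t) 0 →
      s'.reg 7 = q' (t + 1) - q (t + 1) → s'.reg 12 = (2 * (t + 1) + 3 : ℕ) →
      s'.reg 13 = (2 * n + 2 + 3 * (t + 1) : ℕ) → s'.reg 14 = (n - (t + 1) : ℕ) →
      NextInv n L V v bad w j s₀ (t + 1) s' := by
    intro s' h0 h1 h2 h3 h4 h5 h6 h7
    refine ⟨h1, ?_, h2, h4, h5, h6, h7⟩
    rw [← hD, ← hD', splice_succ_of_eq h0, h3]
    exact ha'
  have change : ∀ s', ∀ x : ℤ, x = D' t → Consts n L V s' → Frame [0] s₀ s' →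
      s'.mem = Function.update (Function.update s.mem (2 * n + 3 + 3 * t) 0)
        (2 * n + 2 + 3 * t) x →
      s'.reg 7 = q' (t + 1) - q (t + 1) → s'.reg 12 = (2 * (t + 1) + 3 : ℕ) →
      s'.reg 13 = (2 * n + 2 + 3 * (t + 1) : ℕ) → s'.reg 14 = (n - (t + 1) : ℕ) →
      NextInv n L V v bad w j s₀ (t + 1) s' := by
    rintro s' x rfl h1 h2 h3 h4 h5 h6 h7
    refine ⟨h1, ?_, h2, h4, h5, h6, h7⟩
    rw [← hD, ← hD', splice_succ t D' D, h3]
    exact ha'.put_guess t (D' t)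
  have b1 := hF.addr
  have b2 : L + 1 ≤ B := (Nat.le_mul_self _).trans hF.sq
  have b3 : D t < L + 1 := digit_lt _ (Nat.succ_pos L) j t
  have c0 : q' t = q t ∨ q' t = q t + 1 := quotient_succ_left (Nat.succ_pos L) bad j t
  have c1 := digit_succ_of_eq (K := L + 1) (bad := bad) (j := j) (i := t)
  have c2 := digit_succ_of_lt (K := L + 1) (bad := bad) (j := j) (i := t)
  have c3 := digit_succ_of_eq_base (K := L + 1) (bad := bad) (j := j) (i := t)
  have c4 : t ∉ bad → D' t = D t ∧ q' (t + 1) = q' t ∧ q (t + 1) = q t := by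
    intro hb
    simp only [hD, hD', hq, hq', digit, quotient, if_neg hb, and_self]
  rw [← hD, ← hD', ← hq, ← hq'] at c1 c2 c3
  by_cases hb : t ∈ bad
  all_goals
    simp only [hb, forall_const, not_true_eq_false, not_false_eq_true, false_imp_iff] at c2 c3 c4
    simp only [nextBody, skip, Prog.list, Prog.wp, Instr.wp, State.set_reg, State.set_mem,
      State.put_reg, State.put_mem, Nat.reduceEqDiff, reduceIte, hc.r3, hc.r5, hc.r6, hc.r23,
      hc.r24, h7, h12, h13, h14, e1, e2, e4, e5, e6, Int.toNat_natCast, if_neg a1, if_neg a2,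
      hgt, ha.bad t ht, hb]
    repeat' first | apply And.intro | intro _
    all_goals first
      | refine stay _ ?_ ?_ ?_ rfl ?_ rfl rfl rfl
        · omega
        · repeat first
            | exact hc | apply Consts.put | refine Consts.set ?_ (by omega)
            | refine Consts.skip ?_ rfl
        · repeat first | exact hf | apply Frame.put | refine Frame.set ?_ (by decide)
        · simp only [State.set_reg, State.put_reg, Nat.reduceEqDiff, reduceIte, h7]
          omega
      | refine change _ _ ?_ ?_ ?_ rfl ?_ rfl rfl rfl
        · omega
        · repeat first
            | exact hc | apply Consts.put | refine Consts.set ?_ (by omega)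
            | refine Consts.skip ?_ rfl
        · repeat first | exact hf | apply Frame.put | refine Frame.set ?_ (by decide)
        · simp only [State.set_reg, State.put_reg, Nat.reduceEqDiff, reduceIte, h7]
          omega
      | omega

theorem runs_nextPass (hF : Fits B n L V v) {j : ℕ} {s : State} (hc : Consts n L V s)
    (ha : Arrays n v bad (digit (L + 1) bad j) w s.mem) :
    Runs B nextPass (4 + (n * (nextBody.cost + 1) + 1)) (NextInv n L V v bad w j s n) s := by
  refine Prog.runs_seq_of_wp (p := .seq _ toFirst) ?_
  have hI : ∀ s', NextInv n L V v bad w j s 0 s' →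
      Runs B (.loop 14 nextBody) (n * (nextBody.cost + 1) + 1) (NextInv n L V v bad w j s n) s' := by
    intro s' hs'
    refine Runs.loop (fun i hi s₁ h => ⟨?_, Prog.runs_of_wp ?_⟩) (fun s₁ h => ?_) hs'
    · rw [h.r14]; omega
    · exact nextBody_wp hF hi h
    · rw [h.r14]; omega
  have b1 := hF.addr
  simp only [toFirst, Prog.list, Prog.wp, Instr.wp, State.set_reg,
      Nat.reduceEqDiff, reduceIte, hc.r1, hc.r4, hc.r6, add_zero]
  refine ⟨by omega, by omega, by omega, by omega,
    hI _ ⟨?_, ha, ?_, ?_, rfl, rfl, rfl⟩⟩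
  · repeat first | exact hc | refine Consts.set ?_ (by omega)
  · repeat first | exact Frame.refl _ _ | refine Frame.set ?_ (by decide)
  · simp [State.set_reg, quotient]

/-! ### The loop over the guesses -/

open Classical in
/-- The state after the first `j` guesses have been tested. -/
structure GuessInv (n L : ℕ) (V : ℤ) (v : ℕ → ℤ) (bad : Finset ℕ) (j : ℕ) (s : State) : Prop where
  consts : Consts n L V s
  arrays : Arrays n v bad (digit (L + 1) bad j) (fun _ => 0) s.mem
  r0 : s.reg 0 = if ∃ i < j, Accepts L bad v V i then 1 else 0
  r7 : s.reg 7 = if j < (L + 1) ^ bad.card then 1 else 0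

/-- An upper bound for the number of steps per guess. -/
def guessCost (n L : ℕ) : ℕ :=
  5 + (((L + 1) * (levelCost n + 1) + 1) + (acceptTest.cost +
    ((4 + (n * (nextBody.cost + 1) + 1)) + 1)))

open Classical in
theorem runs_guessBody (hn : n = 2 ^ L) (hF : Fits B n L V v) (hbad : ∀ t ∈ bad, t < n) {j : ℕ}
    (hj : j < (L + 1) ^ bad.card) {s : State} (h : GuessInv n L V v bad j s) :
    Runs B guessBody (guessCost n L) (GuessInv n L V v bad (j + 1)) s := by
  obtain ⟨hc, ha, h0, h7⟩ := h
  have hg : ∀ i < n, digit (L + 1) bad j i ≤ L := fun i _ =>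
    Nat.le_of_lt_succ (digit_lt _ (Nat.succ_pos L) j i)
  have b1 := hF.addr
  have b2 : L + 1 ≤ B := (Nat.le_mul_self _).trans hF.sq
  set g := digit (L + 1) bad j with hgdef
  refine Runs.seq (R := LevelInv n L V v bad g s 0) ?_ fun s₁ h₁ => ?_
  · refine Prog.runs_of_wp (p := levelInit) ?_
    simp only [levelInit, Prog.list, Prog.wp, Instr.wp, State.set_reg,
      Nat.reduceEqDiff, reduceIte, hc.r3, hc.r5, hc.r6, add_zero]
    refine ⟨by omega, by omega, by omega, by omega, by omega, ?_, ha, ?_, ?_, ?_, ?_, ?_, rfl⟩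
    · repeat first | exact hc | refine Consts.set ?_ (by omega)
    · repeat first | exact Frame.refl _ _ | refine Frame.set ?_ (by decide)
    · simp [State.set_reg]
    · simp [State.set_reg, labelCount, labels]
    · simp [State.set_reg, labelSum, labels]
    · simp [State.set_reg]
  refine Runs.seq (R := LevelInv n L V v bad g s (L + 1)) ?_ fun s₂ h₂ => ?_
  · refine Runs.loop (Inv := LevelInv n L V v bad g s) (fun i hi s' h' => ⟨?_, ?_⟩)
      (fun s' h' => ?_) h₁
    · rw [h'.r15]; omega
    · exact runs_levelBody hF hg hi h'
    · rw [h'.r15]; push_cast; omega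
  set w := labels n bad g L (L + 1) with hw
  have hacc : Accepts L bad v V j ↔ n ≤ labelCount n w ∧ V ≤ labelSum n v w := by
    rw [Accepts, ← hn]
  refine Runs.seq (R := fun s' => Consts n L V s' ∧ Arrays n v bad g w s'.mem ∧
    s'.reg 0 = if ∃ i < j + 1, Accepts L bad v V i then 1 else 0) ?_
    fun s₃ h₃ => ?_
  · have b3 := hF.sum w fun i => labels_le le_rfl i
    have b4 := labelCount_le n w
    have hc₂ := h₂.consts
    have h0' : s₂.reg 0 = _ := (h₂.frame 0 (by simp)).trans h0
    have hyes : Accepts L bad v V j → ∃ i < j + 1, Accepts L bad v V i :=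
      fun h => ⟨j, by omega, h⟩
    have hno : ¬ Accepts L bad v V j →
        ((∃ i < j + 1, Accepts L bad v V i) ↔ ∃ i < j, Accepts L bad v V i) := by
      intro h
      constructor
      · rintro ⟨i, hi, hi'⟩
        rcases Nat.lt_succ_iff_lt_or_eq.1 hi with h3 | h3
        exacts [⟨i, h3, hi'⟩, absurd (h3 ▸ hi') h]
      · rintro ⟨i, hi, hi'⟩
        exact ⟨i, by omega, hi'⟩
    refine Prog.runs_of_wp (p := acceptTest) ?_
    simp only [acceptTest, skip, Prog.list, Prog.wp, Instr.wp, State.set_reg,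
      Nat.reduceEqDiff, reduceIte, hc₂.r1, hc₂.r2, h₂.r10, h₂.r11, ← hw]
    refine ⟨by omega, fun hlt => ⟨by omega, ?_, h₂.arrays, ?_⟩, fun hle => ⟨by omega,
      fun hlt => ⟨by omega, ?_, h₂.arrays, ?_⟩, fun hle' => ⟨by omega, ?_, h₂.arrays, ?_⟩⟩⟩
    · exact (hc₂.set (by omega)).skip rfl
    · rw [if_congr (hno (hacc.not.2 (by omega))) rfl rfl]
      exact h0'
    · exact ((hc₂.set (by omega)).set (by omega)).skip rfl
    · rw [if_congr (hno (hacc.not.2 (by omega))) rfl rfl]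
      exact h0'
    · exact ((hc₂.set (by omega)).set (by omega)).set (by omega)
    · rw [if_pos (hyes (hacc.2 ⟨by omega, by omega⟩))]
  obtain ⟨hc₃, ha₃, h0₃⟩ := h₃
  refine Runs.seq (runs_nextPass hF hc₃ ha₃) fun s₄ h₄ => ?_
  have hc₄ := h₄.consts
  -- The final carry is one exactly when the counter overflows, that is, when all guesses have been
  -- tried; its complement controls the loop.
  have hq1 : quotient (L + 1) bad j n = 0 := by
    rw [quotient_of_subset hbad, Nat.div_eq_of_lt hj]
  have hq2 := quotient_of_subset (K := L + 1) hbad (j + 1)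
  have hr7 : 1 - s₄.reg 7 = if j + 1 < (L + 1) ^ bad.card then 1 else 0 := by
    rw [h₄.r7, hq1, hq2]
    split_ifs with hlt
    · rw [Nat.div_eq_of_lt hlt]; rfl
    · rw [show j + 1 = (L + 1) ^ bad.card by omega, Nat.div_self (pow_pos (Nat.succ_pos L) _)]
      rfl
  refine Instr.runs_of_wp ?_
  simp only [Instr.wp, hc₄.r5, hr7]
  refine ⟨by split_ifs <;> omega, hc₄.set (by omega), ?_, ?_, rfl⟩
  · exact h₄.arrays.congr (fun i hi => splice_of_lt hi) (fun i hi => splice_of_lt hi)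
  · rw [← h0₃, ← h₄.frame 0 (by simp)]
    rfl

theorem runs_guessLoop (hn : n = 2 ^ L) (hF : Fits B n L V v) (hbad : ∀ t ∈ bad, t < n)
    {s : State} (h : GuessInv n L V v bad 0 s) :
    Runs B (.loop 7 guessBody) ((L + 1) ^ bad.card * (guessCost n L + 1) + 1)
      (GuessInv n L V v bad ((L + 1) ^ bad.card)) s := by
  refine Runs.loop (Inv := GuessInv n L V v bad) (fun j hj s' h' => ⟨?_, ?_⟩) (fun s' h' => ?_) h
  · rw [h'.r7, if_pos hj]; exact one_pos
  · exact runs_guessBody hn hF hbad hj h'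
  · rw [h'.r7, if_neg (lt_irrefl _)]

end Loops

end Tournament

namespace Tournament

open RAM RAM.Instr RAM.Prog

section Setup

variable {B n L : ℕ} {V : ℤ} {v : ℕ → ℤ}

/-! ### The search for bad players -/

/-- The stack `st`, with its top first, in the memory. -/
def StackIn (n : ℕ) (m : ℕ → ℤ) : List ℕ → Prop
  | [] => True
  | a :: st => m (2 * n + 4 + 3 * st.length) = (2 * a + 3 : ℕ) ∧ StackIn n m st

theorem StackIn.update {m : ℕ → ℤ} {a : ℕ} {x : ℤ} : ∀ {st : List ℕ}, StackIn n m st →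
    (∀ k < st.length, 2 * n + 4 + 3 * k ≠ a) → StackIn n (Function.update m a x) st
  | [], _, _ => trivial
  | b :: st, h, ha => by
    refine ⟨?_, StackIn.update h.2 fun k hk => ha k (Nat.lt_succ_of_lt hk)⟩
    rw [Function.update_of_ne (ha _ (Nat.lt_succ_self _)), h.1]

theorem length_stackStep_le (i : ℕ) (st : List ℕ) (bad : Finset ℕ) :
    (stackStep v i (st, bad)).1.length ≤ st.length + 1 := by
  rcases st with _ | ⟨a, st⟩
  · rfl
  · rw [stackStep]
    split_ifs <;> simp only [List.length_cons] <;> omega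

theorem length_stackRun_le (v : ℕ → ℤ) : ∀ i, (stackRun v i).1.length ≤ i
  | 0 => le_rfl
  | i + 1 => (length_stackStep_le i _ _).trans (Nat.succ_le_succ (length_stackRun_le v i))

/-- The state after the first `i` players have been processed in the search for bad players. -/
structure StackMem (n L : ℕ) (V : ℤ) (v : ℕ → ℤ) (i : ℕ) (st : List ℕ) (bad : Finset ℕ)
    (s : State) : Prop where
  consts : Consts n L V s
  val : ∀ t < n, s.mem (2 * t + 3) = v t
  bad : ∀ t < i, s.mem (2 * t + 2) = if t ∈ bad then 1 else 0
  guess : ∀ t < n, s.mem (2 * n + 2 + 3 * t) = 0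
  lab : ∀ t < n, s.mem (2 * n + 3 + 3 * t) = 0
  stack : StackIn n s.mem st
  r0 : s.reg 0 = 0
  r9 : s.reg 9 = st.length
  r12 : s.reg 12 = (2 * i + 3 : ℕ)
  r13 : s.reg 13 = (2 * n + 4 + 3 * st.length : ℕ)
  r14 : s.reg 14 = (n - i : ℕ)

/-- Stack entries are addresses of value cells, and the bad flag of a player sits one cell below.
The flag of `i` overwrites the player's number, which is not needed. The stack lives in the slot
cells; what remains there is harmless, since the backward pass rewrites them before they are read.
-/
theorem stackBody_wp (hF : Fits B n L V v) {i : ℕ} (hi : i < n) {s : State} {st : List ℕ}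
    {bad : Finset ℕ} (hinv : StackInv v i st bad) (hlen : st.length ≤ i)
    (h : StackMem n L V v i st bad s) :
    stackBody.wp B (StackMem n L V v (i + 1) (stackStep v i (st, bad)).1
      (stackStep v i (st, bad)).2) s := by
  obtain ⟨hc, hv, hb, hg, hl, hst, h0, h9, h12, h13, h14⟩ := h
  have hib : i ∉ bad := fun h => lt_irrefl _ (hinv.lt i h)
  have e1 : ((2 * i + 3 : ℕ) : ℤ) + 2 = (2 * (i + 1) + 3 : ℕ) := by omega
  have e5 : ((2 * i + 3 : ℕ) : ℤ) - 1 = (2 * i + 2 : ℕ) := by omega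
  have e6 : ((n - i : ℕ) : ℤ) - 1 = (n - (i + 1) : ℕ) := by omega
  have b1 := hF.addr
  have b2 := hF.val i hi
  have a1 : 2 * i + 1 ≠ 2 * i := by omega
  have push : ∀ s', Consts n L V s' →
      s'.mem = Function.update (Function.update s.mem (2 * i + 2) 0)
        (2 * n + 4 + 3 * st.length) (2 * i + 3 : ℕ) → s'.reg 0 = 0 → s'.reg 9 = st.length + 1 →
      s'.reg 12 = (2 * (i + 1) + 3 : ℕ) → s'.reg 13 = (2 * n + 4 + 3 * (st.length + 1) : ℕ) →
      s'.reg 14 = (n - (i + 1) : ℕ) → StackMem n L V v (i + 1) (i :: st) bad s' := by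
    intro s' h1 h2 h3 h4 h5 h6 h7
    refine ⟨h1, fun t ht => ?_, fun t ht => ?_, fun t ht => ?_, fun t ht => ?_, ⟨?_, ?_⟩, h3,
      ?_, h5, h6, h7⟩
    · rw [h2, Function.update_of_ne (by omega), Function.update_of_ne (by omega), hv t ht]
    · rw [h2, Function.update_of_ne (by omega)]
      rcases Nat.lt_succ_iff_lt_or_eq.1 ht with h | rfl
      · rw [Function.update_of_ne (by omega), hb t h]
      · simp [hib]
    · rw [h2, Function.update_of_ne (by omega), Function.update_of_ne (by omega), hg t ht]
    · rw [h2, Function.update_of_ne (by omega), Function.update_of_ne (by omega), hl t ht]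
    · simp [h2]
    · rw [h2]
      exact (hst.update fun k hk => by omega).update fun k hk => by omega
    · rw [h4]; simp
  rcases st with _ | ⟨a, st⟩
  · simp only [List.length_nil] at *
    have e2 : ((2 * n + 4 + 3 * 0 : ℕ) : ℤ) + 3 = (2 * n + 4 + 3 * (0 + 1) : ℕ) := by omega
    simp only [stackBody, Prog.list, Prog.wp, Instr.wp, State.set_reg, State.set_mem,
      State.put_reg, State.put_mem, Nat.reduceEqDiff, reduceIte, hc.r5, hc.r6, hc.r23, hc.r24,
      h9, h12, h13, h14, e1, e2, e5, e6, Int.toNat_natCast, if_neg a1, hv i hi, lt_irrefl,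
      false_imp_iff, true_and, Nat.cast_zero, le_refl, forall_const]
    refine ⟨by omega, by omega, by omega, by omega, by omega, by omega, by omega, by omega,
      by omega, push _ ?_ rfl h0 rfl rfl rfl rfl⟩
    repeat first | exact hc | apply Consts.put | refine Consts.set ?_ (by omega)
  · simp only [List.length_cons] at *
    have hai := (hinv.mem_iff a).1 (by simp)
    have a2 : 2 * a + 1 ≠ 2 * i := by omega
    have a3 : 2 * n + 4 + 3 * st.length ≠ 2 * i + 2 := by omega
    have e2 : ((2 * n + 4 + 3 * (st.length + 1) : ℕ) : ℤ) - 3 = (2 * n + 4 + 3 * st.length : ℕ) :=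
      by omega
    have e3 : ((2 * n + 4 + 3 * (st.length + 1) : ℕ) : ℤ) + 3
      = (2 * n + 4 + 3 * (st.length + 1 + 1) : ℕ) := by omega
    have e4 : ((2 * a + 3 : ℕ) : ℤ) - 1 = (2 * a + 2 : ℕ) := by omega
    have b3 := hF.val a (by omega)
    have hpos : (0 : ℤ) < (st.length + 1 : ℕ) := by omega
    have hneg : ¬ ((st.length + 1 : ℕ) : ℤ) ≤ 0 := by omega
    simp only [stackBody, Prog.list, Prog.wp, Instr.wp, State.set_reg, State.set_mem,
      State.put_reg, State.put_mem, Nat.reduceEqDiff, reduceIte, hc.r5, hc.r6, hc.r23, hc.r24,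
      h9, h12, h13, h14, e1, e2, e3, e4, e5, e6, Int.toNat_natCast, if_neg a1, if_neg a2,
      if_neg a3, hv i hi, hv a (show a < n by omega), hst.1, hpos, hneg, forall_const,
      false_imp_iff, and_true]
    refine ⟨by omega, by omega, by omega, by omega, by omega, by omega, by omega, by omega,
      by omega, by omega, fun hlt => ⟨by omega, by omega, by omega, by omega, by omega,
      by omega, by omega, ?_⟩, fun hle => ⟨by omega, by omega, by omega, by omega, by omega, ?_⟩⟩
    · rw [stackStep, if_pos (by omega)]
      refine ⟨?_, fun t ht => ?_, fun t ht => ?_, fun t ht => ?_, fun t ht => ?_, ?_, h0, ?_, rfl,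
        rfl, rfl⟩
      · repeat first | exact hc | apply Consts.put | refine Consts.set ?_ (by omega)
      · simp only [State.set_mem, State.put_mem]
        rw [if_neg (by omega), if_neg (by omega), if_neg (by omega), hv t ht]
      · simp only [State.set_mem, State.put_mem, Finset.mem_insert]
        rcases Nat.lt_succ_iff_lt_or_eq.1 ht with h | rfl
        · by_cases hta : t = a
          · subst hta
            rw [if_neg (by omega), if_pos rfl, if_pos (Or.inl rfl)]
          · rw [if_neg (by omega), if_neg (by omega), if_neg (by omega), hb t h]
            refine if_congr ⟨fun h => Or.inr (Or.inr h), fun h => ?_⟩ rfl rfl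
            rcases h with h | h | h
            exacts [absurd h hta, by omega, h]
        · rw [if_pos rfl, if_pos (Or.inr (Or.inl rfl))]
      · simp only [State.set_mem, State.put_mem]
        rw [if_neg (by omega), if_neg (by omega), if_neg (by omega), hg t ht]
      · simp only [State.set_mem, State.put_mem]
        rw [if_neg (by omega), if_neg (by omega), if_neg (by omega), hl t ht]
      · exact ((hst.2.update fun k hk => by omega).update fun k hk => by omega).update
          fun k hk => by omega
      · simp only [State.set_reg, State.put_reg, Nat.reduceEqDiff, reduceIte, h9]
        omega
    · rw [stackStep, if_neg (by omega)]
      refine push _ ?_ rfl h0 ?_ rfl rfl rfl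
      · repeat first | exact hc | apply Consts.put | refine Consts.set ?_ (by omega)
      · simp only [State.set_reg, State.put_reg, Nat.reduceEqDiff, reduceIte, h9]

/-- The memory after the input of `n` and the target has been read. -/
structure InputMem (n : ℕ) (V : ℤ) (v : ℕ → ℤ) (m : ℕ → ℤ) : Prop where
  count : m 0 = n
  target : m 1 = V
  val : ∀ t < n, m (2 * t + 3) = v t
  zero : ∀ a, 2 * n + 2 ≤ a → m a = 0

theorem runs_stackPass (hF : Fits B n L V v) {s : State} (hc : Consts n L V s)
    (hm : InputMem n V v s.mem) (h0 : s.reg 0 = 0) (h9 : s.reg 9 = 0) :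
    Runs B stackPass (3 + (n * (stackBody.cost + 1) + 1))
      (StackMem n L V v n (stackRun v n).1 (stackRun v n).2) s := by
  refine Prog.runs_seq_of_wp (p := Prog.list [_, _, _]) ?_
  have hI : ∀ s', StackMem n L V v 0 [] ∅ s' →
      Runs B (.loop 14 stackBody) (n * (stackBody.cost + 1) + 1)
        (StackMem n L V v n (stackRun v n).1 (stackRun v n).2) s' := by
    intro s' hs'
    refine Runs.loop (Inv := fun i => StackMem n L V v i (stackRun v i).1 (stackRun v i).2)
      (fun i hi s₁ h => ⟨?_, Prog.runs_of_wp ?_⟩) (fun s₁ h => ?_) hs'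
    · rw [h.r14]; omega
    · exact stackBody_wp hF hi (stackInv v i) (length_stackRun_le v i) h
    · rw [h.r14]; omega
  have b1 := hF.addr
  have e : ((2 * n + 2 : ℕ) : ℤ) + 2 = (2 * n + 4 : ℕ) := by omega
  simp only [Prog.list, Prog.wp, Instr.wp, State.set_reg,
      Nat.reduceEqDiff, reduceIte, hc.r1, hc.r4, hc.r6, hc.r23, e, add_zero]
  refine ⟨by omega, by omega, by omega, hI _ ⟨?_, hm.val, fun t ht => by omega,
    fun t ht => hm.zero _ (by omega), fun t ht => hm.zero _ (by omega), trivial, h0, h9,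
    rfl, rfl, rfl⟩⟩
  repeat first | exact hc | refine Consts.set ?_ (by omega)

/-! ### The number of rounds -/

/-- The state after `j` doublings in the computation of the number of rounds. -/
structure RoundsInv (n : ℕ) (V : ℤ) (v : ℕ → ℤ) (j : ℕ) (s : State) : Prop where
  mem : InputMem n V v s.mem
  r0 : s.reg 0 = 0
  r1 : s.reg 1 = n
  r2 : s.reg 2 = V
  r3 : s.reg 3 = j
  r4 : s.reg 4 = (2 * n + 2 : ℕ)
  r5 : s.reg 5 = 1
  r6 : s.reg 6 = 0
  r9 : s.reg 9 = 0
  r14 : s.reg 14 = (n - 2 ^ j : ℕ)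
  r17 : s.reg 17 = (2 ^ j : ℕ)
  r23 : s.reg 23 = 2
  r24 : s.reg 24 = 3

theorem runs_roundsLoop (hn : n = 2 ^ L) (hF : Fits B n L V v) {s : State}
    (h : RoundsInv n V v 0 s) :
    Runs B (.loop 14 roundsBody) (L * (roundsBody.cost + 1) + 1) (RoundsInv n V v L) s := by
  refine Runs.loop (fun j hj s' h' => ⟨?_, Prog.runs_of_wp ?_⟩) (fun s' h' => ?_) h
  · have := Nat.pow_lt_pow_right (a := 2) (by norm_num) hj
    rw [h'.r14]; omega
  · have b1 := hF.addr
    have b2 : L + 1 ≤ B := (Nat.le_mul_self _).trans hF.sq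
    have h1 := Nat.pow_le_pow_right (n := 2) (by norm_num) (Nat.succ_le_of_lt hj)
    rw [← hn] at h1
    have e1 : ((2 ^ j : ℕ) : ℤ) + (2 ^ j : ℕ) = (2 ^ (j + 1) : ℕ) := by
      rw [pow_succ]; push_cast; ring
    have e2 : (n : ℤ) - (2 ^ (j + 1) : ℕ) = (n - 2 ^ (j + 1) : ℕ) := by omega
    simp only [roundsBody, Prog.list, Prog.wp, Instr.wp, State.set_reg, Nat.reduceEqDiff,
      reduceIte, h'.r1, h'.r3, h'.r5, h'.r17, e1, e2]
    have h2 : (0 : ℤ) ≤ 2 ^ j := by positivity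
    generalize hX : 2 ^ (j + 1) = X at *
    refine ⟨by omega, by omega, by omega, h'.mem, h'.r0, h'.r1, h'.r2, rfl, h'.r4, h'.r5, h'.r6,
      h'.r9, by rw [hX]; rfl, by rw [hX]; rfl, h'.r23, h'.r24⟩
  · rw [h'.r14, ← hn]; simp

/-! ### The whole program -/

theorem levelCost_le (n : ℕ) : levelCost n ≤ 60 * n + 20 := by
  simp only [levelCost, reserveBody, enterBody, skip, Prog.list, Prog.cost]
  norm_num
  omega

/-- Each guess needs `L + 1` levels of linear passes, which gives the extra factor `L + 1`; the
computation of `L` is absorbed by `L + 1 ≤ 2 ^ L + 0 = n` whenever it is bounded by the linear term.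
-/
theorem program_cost_le (hn : n = 2 ^ L) (b : ℕ) :
    setup.cost + ((L * (roundsBody.cost + 1) + 1) + ((3 + (n * (stackBody.cost + 1) + 1)) +
      (1 + ((L + 1) ^ b * (guessCost n L + 1) + 1)))) ≤ 400 * (n * (L + 1) ^ (b + 1)) := by
  have h1 : 1 ≤ n := hn ▸ Nat.one_le_two_pow
  have h2 : L + 1 ≤ n := hn ▸ Nat.lt_two_pow_self
  have h3 := levelCost_le n
  have h4 : guessCost n L + 1 ≤ 200 * (n * (L + 1)) := by
    have e1 : (L + 1) * (levelCost n + 1) ≤ (L + 1) * (81 * n) :=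
      Nat.mul_le_mul_left _ (by omega)
    have e2 : n ≤ n * (L + 1) := Nat.le_mul_of_pos_right n (Nat.succ_pos L)
    have e3 : (L + 1) * (81 * n) = 81 * (n * (L + 1)) := by ring
    have e4 : acceptTest.cost + (4 + (n * (nextBody.cost + 1) + 1) + 1) ≤ 40 * n + 20 := by
      simp only [acceptTest, nextBody, skip, Prog.list, Prog.cost]
      norm_num
      omega
    unfold guessCost
    omega
  have h5 : (L + 1) ^ b * (guessCost n L + 1) ≤ 200 * (n * (L + 1) ^ (b + 1)) :=
    (Nat.mul_le_mul_left _ h4).trans (le_of_eq (by ring))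
  have h6 : n ≤ n * (L + 1) ^ (b + 1) := Nat.le_mul_of_pos_right n (pow_pos (Nat.succ_pos L) _)
  have h7 : setup.cost + ((L * (roundsBody.cost + 1) + 1) + ((3 + (n * (stackBody.cost + 1) + 1))
      + 2)) ≤ 200 * n := by
    simp only [setup, roundsBody, stackBody, Prog.list, Prog.cost]
    norm_num
    omega
  omega

open Classical in
theorem runs_program (hn : n = 2 ^ L) (hF : Fits B n L V v) {s : State}
    (hm : InputMem n V v s.mem) (hs : s.reg = fun _ => 0) :
    Runs B program (400 * (n * (L + 1) ^ ((stackRun v n).2.card + 1)))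
      (fun s' => s'.reg 0 = if ∃ j < (L + 1) ^ (stackRun v n).2.card,
        Accepts L (stackRun v n).2 v V j then 1 else 0) s := by
  set bad := (stackRun v n).2 with hbad
  have b1 := hF.addr
  have b2 := hF.target
  have h1 : 1 ≤ n := hn ▸ Nat.one_le_two_pow
  refine Runs.mono (Q := GuessInv n L V v bad ((L + 1) ^ bad.card)) ?_ (program_cost_le hn _)
    fun s' h => h.r0
  refine Runs.seq (R := RoundsInv n V v 0) ?_ fun s₁ h₁ => ?_
  · refine Prog.runs_of_wp (p := setup) ?_
    have e1 : (n : ℤ) + n + 2 = (2 * n + 2 : ℕ) := by push_cast; ring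
    have e2 : (n : ℤ) - 1 = (n - 2 ^ 0 : ℕ) := by omega
    simp only [setup, Prog.list, Prog.wp, Instr.wp, State.set_reg, State.set_mem,
      Nat.reduceEqDiff, reduceIte, hs, e1, e2, Int.toNat_zero, Int.toNat_one, hm.count, hm.target]
    refine ⟨by omega, by omega, by omega, by omega, by omega, by omega, by omega, by omega,
      by omega, by omega, by omega, hm, ?_, rfl, rfl, ?_, rfl, rfl, ?_, ?_, rfl, rfl, rfl, rfl⟩
    all_goals simp [State.set_reg, hs]
  refine Runs.seq (runs_roundsLoop hn hF h₁) fun s₂ h₂ => ?_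
  refine Runs.seq (runs_stackPass hF ⟨h₂.r1, h₂.r2, h₂.r3, h₂.r4, h₂.r5, h₂.r6, h₂.r23, h₂.r24⟩
    h₂.mem h₂.r0 h₂.r9) fun s₃ h₃ => ?_
  refine Runs.seq (R := GuessInv n L V v bad 0) ?_ fun s₄ h₄ =>
    runs_guessLoop hn hF (stackInv v n).lt h₄
  refine Instr.runs_of_wp ⟨by omega, h₃.consts.set (by omega), ⟨h₃.bad, h₃.val, fun i hi => ?_,
    fun i hi => ?_⟩, ?_, ?_⟩
  · have : digit (L + 1) bad 0 i = 0 := by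
      have : ∀ i, quotient (L + 1) bad 0 i = 0 := by
        intro i
        induction i with
        | zero => rfl
        | succ i ih => rw [quotient, ih]; simp
      simp [digit, this]
    rw [this]
    exact h₃.guess i hi
  · exact h₃.lab i hi
  · simp [State.set_reg, h₃.r0]
  · simp [State.set_reg]

end Setup

end Tournament

namespace Tournament

open RAM

/-! ### The input -/

theorem natAbs_le_maxAbs {l : List ℤ} {x : ℤ} (hx : x ∈ l) : x.natAbs ≤ maxAbs l := by
  induction l with
  | nil => simp at hx
  | cons y l ih =>
    change x.natAbs ≤ max y.natAbs (maxAbs l)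
    rcases List.mem_cons.1 hx with rfl | hx
    · exact le_max_left _ _
    · exact (ih hx).trans (le_max_right _ _)

theorem getD_flatMap_pair (f g : ℕ → ℤ) : ∀ (l : List ℕ) (t : ℕ), t < l.length →
    (l.flatMap fun i => [f i, g i]).getD (2 * t + 1) 0 = g (l.getD t 0)
  | [], t, h => by simp at h
  | a :: l, 0, _ => rfl
  | a :: l, t + 1, h => by
    have := getD_flatMap_pair f g l t (by simpa using h)
    rw [show 2 * (t + 1) + 1 = 2 * t + 1 + 1 + 1 by ring]
    simpa using this

theorem length_flatMap_pair (f g : ℕ → ℤ) (l : List ℕ) :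
    (l.flatMap fun i => [f i, g i]).length = 2 * l.length := by
  induction l with
  | nil => rfl
  | cons a l ih => simp [ih]; ring

namespace Instance

/-- The players, from the strongest to the weakest. -/
noncomputable def player (I : Instance) (t : ℕ) : ℕ := (I.players.sort (· ≥ ·)).getD t 0

variable (I : Instance)

theorem length_sort_players : (I.players.sort (· ≥ ·)).length = I.n := by
  rw [Finset.length_sort]; rfl

theorem n_eq : I.n = 2 ^ I.rounds := I.card_players

theorem player_eq {t : ℕ} (ht : t < I.n) :
    I.player t = (I.players.sort (· ≥ ·))[t]'(by rwa [I.length_sort_players]) :=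
  List.getD_eq_getElem _ _ _

theorem player_mem {t : ℕ} (ht : t < I.n) : I.player t ∈ I.players := by
  rw [I.player_eq ht, ← Finset.mem_sort (· ≥ ·)]
  exact List.getElem_mem _

theorem strictAntiOn_player : StrictAntiOn I.player (Set.Iio I.n) := by
  intro s hs t ht hst
  rw [I.player_eq hs, I.player_eq ht]
  refine lt_of_le_of_ne ?_ fun h => ?_
  · exact List.pairwise_iff_getElem.1 (Finset.pairwise_sort I.players (· ≥ ·)) s t _ _ hst
  · have := (List.Nodup.getElem_inj_iff (Finset.sort_nodup I.players (· ≥ ·))).1 h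
    omega

theorem image_player : I.players = (Finset.range I.n).image I.player := by
  symm
  refine Finset.eq_of_subset_of_card_le (fun j hj => ?_) ?_
  · obtain ⟨t, ht, rfl⟩ := Finset.mem_image.1 hj
    exact I.player_mem (Finset.mem_range.1 ht)
  · rw [Finset.card_image_of_injOn (by simpa using I.strictAntiOn_player.injOn), Finset.card_range]
    exact le_rfl

variable (pop : ℕ → ℤ)

theorem inputMem : InputMem I.n I.target (fun t => pop (I.player t)) (init (I.input pop)).mem := by
  refine ⟨rfl, rfl, fun t ht => ?_, fun a ha => ?_⟩
  · change (I.input pop).getD (2 * t + 1 + 1 + 1) 0 = _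
    exact getD_flatMap_pair (fun i => (i : ℤ)) pop _ t (by rwa [I.length_sort_players])
  · refine List.getD_eq_default _ _ ?_
    rw [input, List.length_cons, List.length_cons,
      length_flatMap_pair (fun i => (i : ℤ)) pop, I.length_sort_players]
    omega

/-- The largest quantity is the target plus a label sum: at most `n` terms, each a value times at
most `L` wins, with all three factors at most `M`. So `M + M ^ 3` is needed, and a fourth power
leaves room for addresses. -/
theorem fits {B : ℕ} (hB : (maxAbs (I.input pop) + 2) ^ 4 ≤ B) :
    Fits B I.n I.rounds I.target (fun t => pop (I.player t)) := by
  obtain ⟨M, hM⟩ : ∃ M, maxAbs (I.input pop) = M := ⟨_, rfl⟩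
  have h1 : I.n ≤ M := by
    have := natAbs_le_maxAbs (l := I.input pop) (x := (I.n : ℤ)) (by simp [input])
    omega
  have h2 : I.target.natAbs ≤ M := by
    rw [← hM]
    exact natAbs_le_maxAbs (by simp [input])
  have h3 : ∀ t < I.n, (pop (I.player t)).natAbs ≤ M := by
    intro t ht
    rw [← hM]
    refine natAbs_le_maxAbs ?_
    simp only [input, List.mem_cons, List.mem_flatMap]
    exact Or.inr (Or.inr ⟨I.player t, (Finset.mem_sort _).2 (I.player_mem ht), by simp⟩)
  have h4 : I.rounds + 1 ≤ M := le_trans (by rw [I.n_eq]; exact Nat.lt_two_pow_self) h1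
  rw [hM] at hB
  have e : (M + 2) ^ 4 = M * M * M * M + 8 * (M * M * M) + 24 * (M * M) + 32 * M + 16 := by ring
  have e2 : M ≤ M * M := Nat.le_mul_self M
  refine ⟨by omega, ?_, by omega, fun i hi => ?_, fun i hi => ?_, fun w hw => ?_⟩
  · have := Nat.mul_le_mul h4 h4
    omega
  · have := h3 i hi
    omega
  · have := Nat.mul_le_mul (h3 i hi) (show I.rounds ≤ M by omega)
    omega
  · have h5 : (labelSum I.n (fun t => pop (I.player t)) w).natAbs ≤ M * (M * M) := by
      calc _ ≤ ∑ t ∈ Finset.range I.n, (pop (I.player t) * (w t - 1 : ℕ)).natAbs :=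
            Int.natAbs_sum_le _ _
        _ ≤ ∑ t ∈ Finset.range I.n, M * M := by
            refine Finset.sum_le_sum fun t ht => ?_
            rw [Int.natAbs_mul, Int.natAbs_natCast]
            exact Nat.mul_le_mul (h3 t (Finset.mem_range.1 ht)) (by have := hw t; omega)
        _ = I.n * (M * M) := by rw [Finset.sum_const, Finset.card_range, smul_eq_mul]
        _ ≤ _ := Nat.mul_le_mul_right _ h1
    have e3 : M * (M * M) = M * M * M := by ring
    omega

theorem isYes_iff_accepts (h : I.IsPopularityBased pop) :
    I.IsYes ↔ ∃ j < (I.rounds + 1) ^ (stackRun (fun t => pop (I.player t)) I.n).2.card,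
      Accepts I.rounds (stackRun (fun t => pop (I.player t)) I.n).2
        (fun t => pop (I.player t)) I.target j := by
  have hn := I.n_eq
  rw [I.isYes_iff_winCount pop h, I.image_player,
    exists_winCount_iff I.strictAntiOn_player, ← exists_winSeq_iff_accepts, ← hn]
  · rw [← hn]
    exact (stackInv _ I.n).lt
  · rw [← hn]
    exact fun s hs t ht hs' ht' hst => stackRun_anti (fun t => pop (I.player t)) hs ht hs' ht' hst

end Instance

/-! ### The running time -/

/-- The exponent in excess of one. -/
noncomputable def excess (n : ℕ) : ℝ :=
  Real.log (Nat.log 2 n + 1 : ℕ) * (1 + 2 * Real.sqrt (Nat.log 2 n + 1 : ℕ)) / Real.log n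

theorem log_lt_natLog (n : ℕ) (hn : n ≠ 0) : Real.log n < (Nat.log 2 n + 1 : ℕ) := by
  have h1 : (n : ℝ) < 2 ^ (Nat.log 2 n + 1) := by
    exact_mod_cast Nat.lt_pow_succ_log_self (by norm_num) n
  have h2 := Real.log_lt_log (by positivity) h1
  rw [Real.log_pow] at h2
  have h3 : Real.log 2 ≤ 1 := by have := Real.log_two_lt_d9; linarith
  have h4 : (0 : ℝ) ≤ (Nat.log 2 n + 1 : ℕ) := by positivity
  nlinarith

/-- Multiplied by `log 2`, the left side is at most `2 * log n`, and `2 ≤ 3 * log 2`. -/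
theorem natLog_le_log {n : ℕ} (hn : 2 ≤ n) : ((Nat.log 2 n + 1 : ℕ) : ℝ) ≤ 3 * Real.log n := by
  have h1 : (2 : ℝ) ^ Nat.log 2 n ≤ n := by exact_mod_cast Nat.pow_log_le_self 2 (by omega)
  have h2 := Real.log_le_log (by positivity) h1
  rw [Real.log_pow] at h2
  have h3 : Real.log 2 ≤ Real.log n := Real.log_le_log (by norm_num) (by exact_mod_cast hn)
  have h4 := Real.log_two_gt_d9
  push_cast
  nlinarith [(Nat.log 2 n).cast_nonneg (α := ℝ)]

/-- With `x = Nat.log 2 n + 1`, the excess is at most `3 * (log x / x + 2 * log x / √x)`. -/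
theorem tendsto_excess : Tendsto excess atTop (𝓝 0) := by
  have hK : Tendsto (fun n : ℕ => ((Nat.log 2 n + 1 : ℕ) : ℝ)) atTop atTop := by
    refine tendsto_atTop_mono' atTop ?_ (Real.tendsto_log_atTop.comp tendsto_natCast_atTop_atTop)
    filter_upwards [eventually_ge_atTop 1] with n hn
    exact (log_lt_natLog n (by omega)).le
  have h1 : Tendsto (fun x : ℝ => Real.log x / x ^ (1 : ℝ)) atTop (𝓝 0) :=
    (isLittleO_log_rpow_atTop one_pos).tendsto_div_nhds_zero
  have h2 : Tendsto (fun x : ℝ => Real.log x / x ^ (1 / 2 : ℝ)) atTop (𝓝 0) :=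
    (isLittleO_log_rpow_atTop (by norm_num)).tendsto_div_nhds_zero
  have h3 := ((h1.add (h2.const_mul 2)).const_mul 3).comp hK
  simp only [mul_zero, add_zero] at h3
  refine squeeze_zero' ?_ ?_ h3
  · filter_upwards [eventually_ge_atTop 2] with n hn
    have : 0 < Real.log n := Real.log_pos (by exact_mod_cast hn)
    have : 0 ≤ Real.log (Nat.log 2 n + 1 : ℕ) := Real.log_natCast_nonneg _
    unfold excess
    positivity
  · filter_upwards [eventually_ge_atTop 2] with n hn
    have h4 := natLog_le_log hn
    have h5 : 0 < Real.log n := Real.log_pos (by exact_mod_cast hn)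
    have h6 : (0 : ℝ) < (Nat.log 2 n + 1 : ℕ) := by positivity
    have h7 : 0 ≤ Real.log (Nat.log 2 n + 1 : ℕ) := Real.log_natCast_nonneg _
    simp only [Function.comp, excess]
    generalize ((Nat.log 2 n + 1 : ℕ) : ℝ) = x at *
    rw [Real.rpow_one, ← Real.sqrt_eq_rpow]
    have h8 := Real.sqrt_pos.2 h6
    have h9 := Real.mul_self_sqrt h6.le
    calc Real.log x * (1 + 2 * √x) / Real.log n ≤ Real.log x * (1 + 2 * √x) * (3 / x) := by
          rw [div_eq_mul_inv]
          refine mul_le_mul_of_nonneg_left ?_ (by positivity)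
          rw [inv_eq_one_div, div_le_div_iff₀ h5 h6]
          linarith
      _ = 3 * (Real.log x / x + 2 * (Real.log x / √x)) := by
          have : Real.log x / √x = Real.log x * √x / x := by
            rw [div_eq_div_iff h8.ne' h6.ne', mul_assoc, h9]
          rw [this]
          ring

theorem steps_le {L k b : ℕ} (hb : b ≤ 2 * k) :
    ((400 * (2 ^ L * (L + 1) ^ (b + 1)) : ℕ) : ℝ)
      ≤ (400 : ℕ) * (k : ℝ) ^ (400 * k) * ((2 ^ L : ℕ) : ℝ) ^ (1 + excess (2 ^ L)) := by
  have hk : (1 : ℝ) ≤ (k : ℝ) ^ (400 * k) := by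
    rcases Nat.eq_zero_or_pos k with rfl | hk
    · simp
    · exact one_le_pow₀ (by exact_mod_cast hk)
  have h2 : (0 : ℝ) < ((2 ^ L : ℕ) : ℝ) := by positivity
  have hK1 : (1 : ℝ) ≤ ((L + 1 : ℕ) : ℝ) := by exact_mod_cast Nat.succ_pos L
  -- `excess` is chosen to make this an identity. For `L = 0` its denominator is zero, but both
  -- bases are one.
  have hexc : ((2 ^ L : ℕ) : ℝ) ^ excess (2 ^ L)
      = ((L + 1 : ℕ) : ℝ) ^ (1 + 2 * √((L + 1 : ℕ) : ℝ)) := by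
    rcases Nat.eq_zero_or_pos L with rfl | hL
    · simp
    · have : Real.log ((2 ^ L : ℕ) : ℝ) ≠ 0 := by
        refine (Real.log_pos ?_).ne'
        exact_mod_cast Nat.one_lt_two_pow hL.ne'
      rw [Real.rpow_def_of_pos h2, Real.rpow_def_of_pos (by linarith), excess,
        Nat.log_pow (by norm_num)]
      congr 1
      field_simp
  have hone : (1 : ℝ) ≤ ((L + 1 : ℕ) : ℝ) ^ (1 + 2 * √((L + 1 : ℕ) : ℝ)) :=
    Real.one_le_rpow hK1 (by positivity)
  have hmain : ((L + 1 : ℕ) : ℝ) ^ (b + 1)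
      ≤ (k : ℝ) ^ (400 * k) * ((L + 1 : ℕ) : ℝ) ^ (1 + 2 * √((L + 1 : ℕ) : ℝ)) := by
    have hb' : ((L + 1 : ℕ) : ℝ) ^ (b + 1) ≤ ((L + 1 : ℕ) : ℝ) ^ (2 * k + 1) :=
      pow_le_pow_right₀ hK1 (by omega)
    refine hb'.trans ?_
    -- For small `k` the exponent `2 * k + 1` is at most `1 + 2 * √(L + 1)`, which the excess pays
    -- for; this includes `k = 0`. For large `k`, `L + 1 < k ^ 2`, and everything goes into the
    -- power of `k`.
    rcases le_or_gt (k : ℝ) (√((L + 1 : ℕ) : ℝ)) with h | h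
    · refine le_trans ?_ (le_mul_of_one_le_left (by positivity) hk)
      rw [← Real.rpow_natCast]
      refine Real.rpow_le_rpow_of_exponent_le hK1 ?_
      push_cast at *
      linarith
    · refine le_trans ?_ (le_mul_of_one_le_right (by positivity) hone)
      have hk1 : 1 ≤ k := by
        rcases Nat.eq_zero_or_pos k with rfl | hk
        · exact absurd h (by simp)
        · exact hk
      have h3 : ((L + 1 : ℕ) : ℝ) ≤ (k : ℝ) ^ 2 := by
        have := Real.lt_sq_of_sqrt_lt h
        exact this.le
      calc ((L + 1 : ℕ) : ℝ) ^ (2 * k + 1) ≤ ((k : ℝ) ^ 2) ^ (2 * k + 1) :=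
            pow_le_pow_left₀ (by positivity) h3 _
        _ = (k : ℝ) ^ (2 * (2 * k + 1)) := by rw [← pow_mul]
        _ ≤ _ := pow_le_pow_right₀ (by exact_mod_cast hk1) (by omega)
  rw [Real.rpow_add h2, Real.rpow_one, hexc]
  have h4 := mul_le_mul_of_nonneg_left hmain (show (0 : ℝ) ≤ 400 * ((2 ^ L : ℕ) : ℝ) by positivity)
  push_cast at h4 ⊢
  linarith

end Tournament

/-- One program decides, on a unit-cost RAM with words of `O(log M)` bits, where `M` bounds the
number of players and all numbers of the input, every player popularity-based instance of
Tournament Value Maximization in `k ^ O(k) * n ^ (1 + o(1))` steps. -/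
theorem mainTheorem8 :
    ∃ (P : RAM.Prog) (C : ℕ) (ε : ℕ → ℝ), Tendsto ε atTop (𝓝 0) ∧
      ∀ (I : Tournament.Instance) (pop : ℕ → ℤ), I.IsPopularityBased pop →
        ∃ (t : ℕ) (s : RAM.State),
          RAM.Exec ((RAM.maxAbs (I.input pop) + 2) ^ C) P (RAM.init (I.input pop)) t s ∧
          (I.IsYes → s.reg 0 = 1) ∧ (¬ I.IsYes → s.reg 0 = 0) ∧
          (t : ℝ) ≤ (C : ℝ) * (I.disagreement pop : ℝ) ^ (C * I.disagreement pop)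
            * (I.n : ℝ) ^ (1 + ε I.n) := by
  refine ⟨Tournament.program, 400, Tournament.excess, Tournament.tendsto_excess,
    fun I pop h => ?_⟩
  have hfits : ∀ C, 4 ≤ C → Tournament.Fits ((RAM.maxAbs (I.input pop) + 2) ^ C) I.n I.rounds
      I.target (fun t => pop (I.player t)) := fun C hC =>
    I.fits pop (Nat.pow_le_pow_right (Nat.succ_pos _) hC)
  obtain ⟨t, s, h1, h2, h3⟩ := Tournament.runs_program I.n_eq (hfits 400 (by norm_num))
    (I.inputMem pop) rfl
  refine ⟨t, s, h1, fun hy => ?_, fun hn => ?_, ?_⟩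
  · rw [h3, if_pos ((I.isYes_iff_accepts pop h).1 hy)]
  · rw [h3, if_neg fun h' => hn ((I.isYes_iff_accepts pop h).2 h')]
  · refine le_trans (Nat.cast_le.2 h2) ?_
    rw [I.n_eq]
    exact Tournament.steps_le (by
      rw [← I.n_eq]
      exact Tournament.card_stackRun_le I I.strictAntiOn_player I.image_player)
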